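/- Notation. Identify $\mathbb{R}^2$ with $\mathbb{C}$. Let $D\subset\mathbb{R}^2$ be a domain, i.e. a nonempty connected open set ($D=\mathbb{C}$ is allowed), let $w:D\to[0,\infty)$ be a measurable weight, and put $\mu(C)=\int_C w(z)\,dz$ for $C\subset D$, $F_D^w=\frac1{\mu(D)}\int_D F w\,dz$, and $\|F\|_{L^p(D,w)}^p=\int_D|F|^p w\,dz$. For $1\le p<\infty$ let $W^{1,p}(D,w)\cap\mathcal M(D)$ be the set of meromorphic functions $F$ on $D$ with $F\in L^p(D,w)$ and $|\nabla F|\in L^p(D,w)$, where $\nabla F=(\partial_xF,\partial_yF)$ is the classical gradient off the poles and $|\nabla F|=(|\partial_xF|^2+|\partial_yF|^2)^{1/2}$. The Poincar\'e constant $C_{poinc}(p,D,w)\in[0,\infty]$ is the optimal constant $C$ such that $\|F-F_D^w\|_{L^p(D,w)}\le C\,\|\nabla F\|_{L^p(D,w)}$ for all $F\in W^{1,p}(D,w)\cap\mathcal M(D)$. The Cheeger constant is $$h(D,w)=\inf_C\frac{\int_{\partial C\cap D}w\,d\sigma}{\mu(C)}\in[0,\infty],$$ where $\sigma$ is arc length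 and the infimum is over all open $C\subset D$ such that $\partial C\cap D$ is a (possibly empty) smooth embedded $1$-dimensional submanifold and $0<\mu(C)\le\frac12\mu(D)$; a quotient with $\mu(C)=\infty$ counts as $0$. For a tempered distribution $f\in\mathcal S'(\mathbb{R})$ let $V_\varphi f(x,y)=\big(f,\ e^{-\pi(\cdot-x)^2}e^{-2\pi i y\,\cdot}\big)$ be its Gabor transform and $h_{p,D}(f)=h(D,|V_\varphi f|^p)$. We read $4p/0=\infty$ and $4p/\infty=0$. Theorem. Let $D\subset\mathbb{R}^2$ be a domain and $1\le p<\infty$. (i) Let $w$ be a nonnegative integrable weight on $D$ whose Cheeger constant $h=h(D,w)$ is positive. Then $$\|F-F_D^w\|_{L^p(D,w)}\le\frac{4p}{h}\,\|\nabla F\|_{L^p(D,w)}\qquad\text{for all }F\in W^{1,p}(D,w)\cap L^1(D,w)\cap\mathcal M(D),$$ and $C_{poinc}(p,D,w)\le 4p/h$. (ii) For every $f\in\mathcal S'(\mathbb{R})$, $$C_{poinc}(p,D,|V_\varphi f|^p)\le\frac{4p}{h_{p,D}(f)}.$$ -/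

import Mathlib

open MeasureTheory Set
open scoped ENNReal NNReal SchwartzMap ContDiff

noncomputable section

/-! ## The Gabor transform of a tempered distribution -/

/-- The function `t ↦ exp (-π (t - x)²) exp (-2 π i y t)`: the time-frequency shifted Gaussian
(the Gaussian is real, so no conjugation is needed). -/
def gaborAtomFun (x y : ℝ) (t : ℝ) : ℂ :=
  Complex.exp (-Real.pi * ((t : ℂ) - x) ^ 2) * Complex.exp (-2 * Real.pi * Complex.I * y * t)

theorem gaborAtomFun_norm (x y t : ℝ) :
    ‖gaborAtomFun x y t‖ = Real.exp (-Real.pi * (t - x) ^ 2) := by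
  unfold gaborAtomFun
  have h1 : (-Real.pi * ((t : ℂ) - x) ^ 2 : ℂ) = ((-Real.pi * (t - x) ^ 2 : ℝ) : ℂ) := by
    push_cast; ring
  have h2 : (-2 * Real.pi * Complex.I * y * t : ℂ)
      = ((-2 * Real.pi * y * t : ℝ) : ℂ) * Complex.I := by
    push_cast; ring
  rw [norm_mul, h1, h2, Complex.norm_exp_ofReal_mul_I, mul_one, ← Complex.ofReal_exp,
    Complex.norm_real, Real.norm_of_nonneg (Real.exp_pos _).le]

theorem gaborAtomFun_hasDerivAt (x y t : ℝ) :
    HasDerivAt (gaborAtomFun x y)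
      ((-2 * Real.pi * ((t : ℂ) - x) - 2 * Real.pi * Complex.I * y) * gaborAtomFun x y t) t := by
  have hid : HasDerivAt (fun t : ℝ => (t : ℂ)) 1 t := Complex.ofRealCLM.hasDerivAt
  have h1 := ((((hid.sub_const (x : ℂ)).pow 2).const_mul (-Real.pi : ℂ))).cexp
  have h2 := (hid.const_mul (-2 * Real.pi * Complex.I * y : ℂ)).cexp
  have h := h1.mul h2
  refine h.congr_deriv ?_
  simp only [gaborAtomFun]
  push_cast
  simp only [Pi.pow_apply]
  ring

theorem gaborAtomFun_contDiff (x y : ℝ) : ContDiff ℝ ∞ (gaborAtomFun x y) := by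
  have h : ContDiff ℝ ∞ (fun t : ℝ => (t : ℂ)) := Complex.ofRealCLM.contDiff
  unfold gaborAtomFun
  exact ((contDiff_const.mul ((h.sub contDiff_const).pow 2)).cexp).mul
    ((contDiff_const.mul h).cexp)

theorem gaborAtomFun_iteratedDeriv (x y : ℝ) (n : ℕ) :
    ∃ P : Polynomial ℂ, ∀ t : ℝ,
      iteratedDeriv n (gaborAtomFun x y) t = P.eval (t : ℂ) * gaborAtomFun x y t := by
  induction n with
  | zero => exact ⟨1, fun t => by simp⟩
  | succ n ih =>
    obtain ⟨P, hP⟩ := ih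
    refine ⟨P.derivative + P * (Polynomial.C (-2 * Real.pi : ℂ) * (Polynomial.X - Polynomial.C (x : ℂ))
      - Polynomial.C (2 * Real.pi * Complex.I * y : ℂ)), fun t => ?_⟩
    rw [iteratedDeriv_succ, funext hP]
    have hp : HasDerivAt (fun t : ℝ => P.eval (t : ℂ)) (P.derivative.eval (t : ℂ)) t :=
      (P.hasDerivAt (t : ℂ)).comp_ofReal
    refine (hp.mul (gaborAtomFun_hasDerivAt x y t)).deriv.trans ?_
    simp only [Polynomial.eval_add, Polynomial.eval_mul, Polynomial.eval_sub, Polynomial.eval_C,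
      Polynomial.eval_X]
    ring

theorem gaborAtomFun_pow_bound (x y : ℝ) (n : ℕ) :
    ∃ C : ℝ, ∀ t : ℝ, |t| ^ n * ‖gaborAtomFun x y t‖ ≤ C := by
  refine ⟨n.factorial * Real.exp (1 + Real.pi * x ^ 2), fun t => ?_⟩
  have h1 : |t| ^ n ≤ n.factorial * Real.exp |t| := by
    have h := Real.pow_div_factorial_le_exp |t| (abs_nonneg t) n
    rw [div_le_iff₀ (by positivity)] at h
    linarith
  have h2 : |t| ≤ 1 + Real.pi * t ^ 2 / 2 := by
    have hpi := Real.pi_gt_three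
    have : |t| ^ 2 = t ^ 2 := sq_abs t
    nlinarith [sq_nonneg (|t| - 1), abs_nonneg t, sq_nonneg t]
  have h3 : |t| + -Real.pi * (t - x) ^ 2 ≤ 1 + Real.pi * x ^ 2 := by
    have hpi := Real.pi_pos
    nlinarith [mul_nonneg hpi.le (sq_nonneg (t - 2 * x))]
  rw [gaborAtomFun_norm]
  calc |t| ^ n * Real.exp (-Real.pi * (t - x) ^ 2)
      ≤ n.factorial * Real.exp |t| * Real.exp (-Real.pi * (t - x) ^ 2) := by gcongr
    _ = n.factorial * Real.exp (|t| + -Real.pi * (t - x) ^ 2) := by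
        rw [Real.exp_add]; ring
    _ ≤ _ := by gcongr

/-- The time-frequency shifted Gaussian as a Schwartz function. -/
def gaborAtom (x y : ℝ) : 𝓢(ℝ, ℂ) where
  toFun := gaborAtomFun x y
  smooth' := gaborAtomFun_contDiff x y
  decay' := by
    intro k n
    obtain ⟨P, hP⟩ := gaborAtomFun_iteratedDeriv x y n
    choose C hC using fun i => gaborAtomFun_pow_bound x y (k + i)
    refine ⟨∑ i ∈ P.support, ‖P.coeff i‖ * C i, fun t => ?_⟩
    rw [norm_iteratedFDeriv_eq_norm_iteratedDeriv, hP t, norm_mul, Real.norm_eq_abs,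
      Polynomial.eval_eq_sum, Polynomial.sum_def]
    calc |t| ^ k * (‖∑ i ∈ P.support, P.coeff i * (t : ℂ) ^ i‖ * ‖gaborAtomFun x y t‖)
        ≤ |t| ^ k * ((∑ i ∈ P.support, ‖P.coeff i‖ * |t| ^ i) * ‖gaborAtomFun x y t‖) := by
          gcongr
          refine (norm_sum_le _ _).trans (le_of_eq (Finset.sum_congr rfl fun i _ => ?_))
          rw [norm_mul, norm_pow, Complex.norm_real, Real.norm_eq_abs]
      _ = ∑ i ∈ P.support, ‖P.coeff i‖ * (|t| ^ (k + i) * ‖gaborAtomFun x y t‖) := by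
          rw [Finset.sum_mul, Finset.mul_sum]
          refine Finset.sum_congr rfl fun i _ => ?_
          rw [pow_add]; ring
      _ ≤ _ := by
          gcongr with i _
          exact hC i t

/-- The Gabor transform `V_φ f (x, y)` of a tempered distribution `f`, with the Gaussian window
`φ (t) = exp (-π t²)`: the pairing of `f` with `t ↦ φ (t - x) exp (-2 π i y t)`. -/
def gaborTransform (f : 𝓢'(ℝ, ℂ)) (x y : ℝ) : ℂ := f (gaborAtom x y)

/-- The weight `|V_φ f|^p` on the plane `ℝ² = ℂ`. -/
def gaborWeight (p : ℝ) (f : 𝓢'(ℝ, ℂ)) (z : ℂ) : ℝ := ‖gaborTransform f z.re z.im‖ ^ p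

/-! ## Weighted spaces on a planar domain -/

/-- The measure `w(z) dz` on `D`. -/
def weightedMeasure (D : Set ℂ) (w : ℂ → ℝ) : Measure ℂ :=
  (volume.restrict D).withDensity fun z => ENNReal.ofReal (w z)

/-- The weighted mean `F_D^w = (1 / w(D)) ∫_D F(z) w(z) dz`, where `w(D) = ∫_D w(z) dz`. -/
def weightedMean (D : Set ℂ) (w : ℂ → ℝ) (F : ℂ → ℂ) : ℂ :=
  (1 / ((∫ z in D, w z : ℝ) : ℂ)) * ∫ z in D, F z * (w z : ℂ)

/-- The Euclidean length `|∇F| = (|∂ₓF|² + |∂_yF|²)^{1/2}` of the gradient of a complex-valued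
function on the plane, at points where it is differentiable. -/
def gradNorm (F : ℂ → ℂ) (z : ℂ) : ℝ :=
  Real.sqrt (‖fderiv ℝ F z 1‖ ^ 2 + ‖fderiv ℝ F z Complex.I‖ ^ 2)

/-- `‖F‖_{L^p(D,w)}`, as an extended nonnegative real. -/
def weightedNorm {E : Type*} [NormedAddCommGroup E] (p : ℝ) (D : Set ℂ) (w : ℂ → ℝ)
    (F : ℂ → E) : ℝ≥0∞ :=
  eLpNorm F (ENNReal.ofReal p) (weightedMeasure D w)

/-- `F ∈ 𝓜(D) ∩ W^{1,p}(D,w)`: `F` is meromorphic on `D`, and `F` and its (classical, defined off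
the discrete set of poles) gradient lie in `L^p(D,w)`. -/
structure IsMeromorphicSobolev (p : ℝ) (D : Set ℂ) (w : ℂ → ℝ) (F : ℂ → ℂ) : Prop where
  meromorphicOn : MeromorphicOn F D
  memLp : MemLp F (ENNReal.ofReal p) (weightedMeasure D w)
  grad_memLp : MemLp (gradNorm F) (ENNReal.ofReal p) (weightedMeasure D w)

/-- `C_poinc(p, D, w)`: the optimal constant `C` such that
`‖F - F_D^w‖_{L^p(D,w)} ≤ C ‖∇F‖_{L^p(D,w)}` for all `F ∈ W^{1,p}(D,w) ∩ 𝓜(D)`; it is `∞` if no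
finite constant works. -/
def poincareConstant (p : ℝ) (D : Set ℂ) (w : ℂ → ℝ) : ℝ≥0∞ :=
  ⨅ (C : ℝ≥0) (_ : ∀ F : ℂ → ℂ, IsMeromorphicSobolev p D w F →
    weightedNorm p D w (fun z => F z - weightedMean D w F) ≤
      (C : ℝ≥0∞) * weightedNorm p D w (gradNorm F)), (C : ℝ≥0∞)

/-! ## The Cheeger constant -/

/-- `M` is a smooth embedded curve in the plane, i.e. a (possibly empty) one-dimensional embedded
`C^∞` submanifold without boundary: locally it is the zero set of a smooth real function with
non-vanishing differential. -/
def IsSmoothCurve (M : Set ℂ) : Prop :=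
  ∀ x ∈ M, ∃ (U : Set ℂ) (g : ℂ → ℝ), IsOpen U ∧ x ∈ U ∧ ContDiffOn ℝ ∞ g U ∧
    (∀ y ∈ U, fderiv ℝ g y ≠ 0) ∧ ∀ y ∈ U, y ∈ M ↔ g y = 0

/-- The competitors in the definition of the Cheeger constant: open `C ⊆ D` whose relative boundary
`∂C ∩ D` is a smooth curve and with `μ(C) ≤ μ(D) / 2`, where `μ = w(z) dz`. Sets with `μ(C) = 0`
(for which the Cheeger ratio is not defined) are excluded. -/
structure IsCheegerCompetitor (D : Set ℂ) (w : ℂ → ℝ) (C : Set ℂ) : Prop where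
  subset : C ⊆ D
  isOpen : IsOpen C
  isSmoothCurve : IsSmoothCurve (frontier C ∩ D)
  measure_pos : 0 < weightedMeasure D w C
  measure_le : weightedMeasure D w C ≤ weightedMeasure D w D / 2

/-- `ν(A) = ∫_A w dσ` with respect to arc length (the one-dimensional Hausdorff measure). -/
def weightedLength (w : ℂ → ℝ) (A : Set ℂ) : ℝ≥0∞ :=
  ∫⁻ z in A, ENNReal.ofReal (w z) ∂(Measure.hausdorffMeasure 1 : Measure ℂ)

/-- The Cheeger constant `h(D, w) = inf_C ν(∂C ∩ D) / μ(C)`, where a ratio with `μ(C) = ∞` counts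
as `0`. -/
def cheegerConstant (D : Set ℂ) (w : ℂ → ℝ) : ℝ≥0∞ :=
  ⨅ (C : Set ℂ) (_ : IsCheegerCompetitor D w C),
    weightedLength w (frontier C ∩ D) / weightedMeasure D w C

/-- The `p`-Cheeger constant `h_{p,D}(f)` of a tempered distribution `f`. -/
def gaborCheegerConstant (p : ℝ) (D : Set ℂ) (f : 𝓢'(ℝ, ℂ)) : ℝ≥0∞ :=
  cheegerConstant D (gaborWeight p f)

end

open Filter Topology
open scoped MeasureTheory

/-!
Let `μ = w dz` on `D` and let `h` be the Cheeger constant. The classical argument applies to a real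
function `v` which is smooth near almost all of its level sets: for `t` above a median `m` of `v`,
the superlevel set `{v > t}` has at most half of the mass and is bounded by the curve `{v = t}`, so
`h μ{v > t} ≤ ∫_{v = t} w dσ`. Integrating this against `p (t - m) ^ (p - 1) dt`, with the layer cake
formula on the left and the coarea inequality `exists_coarea_le` on the right, and doing the same for
`-v`, gives `h ∫ |v - m|^p dμ ≤ p ∫ |v - m|^(p - 1) |∇v| dμ`, and Hölder's inequality gives
`h ‖v - m‖_p ≤ p ‖∇v‖_p` (`IsRegularOff.exists_cheegerConstant_mul_eLpNorm_sub_le`).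

Neither `Re F` nor `Im F` can be taken for `v` directly, as level sets of `Re F` all run into the
poles of `F`, where they need not form a smooth curve. Instead, `v = Re F / (1 + ε |F|²)` is used.
This is, up to scaling, a coordinate function of the Riemann sphere composed with `F`. Hence it
extends continuously by `0` to the poles, its gradient is at most `|F'|`, and its critical points are
critical points of `F` or points where `F = ± 1 / √ε`; so all but countably many levels are regular,
and Sard's theorem is not needed (`exists_isRegularOff_sphericalRe`). The same holds for `Im F`, the
real part of `-i F`. Together these bound `F / (1 + ε |F|²)`, with a factor `2` for the two parts and
a factor `2` for replacing medians by the mean, and `ε → 0` gives the inequality for `F`.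

For a Gabor weight, a positive Cheeger constant forces `μ(D) < ∞`, because otherwise `D` itself would
be a competitor with ratio `0`. Since the weight is continuous, it is then integrable on `D`.
-/

/-! ### The coarea inequality for regular functions on the plane -/

/-- On a vertical line, arc length is Lebesgue measure. -/
theorem hausdorffMeasure_one_inter_re_eq (B : Set ℂ) (s : ℝ) :
    μH[1] (B ∩ {z | z.re = s}) = volume {y : ℝ | (⟨s, y⟩ : ℂ) ∈ B} := by
  have hiso : Isometry (fun y : ℝ => (⟨s, y⟩ : ℂ)) := by
    refine Isometry.of_dist_eq fun x y => ?_
    exact Complex.dist_of_re_eq rfl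
  rw [← hausdorffMeasure_real, ← hiso.hausdorffMeasure_image (Or.inl zero_le_one)]
  congr 1
  ext z
  constructor
  · rintro ⟨hz, rfl⟩
    exact ⟨z.im, hz, rfl⟩
  · rintro ⟨y, hy, rfl⟩
    exact ⟨hy, rfl⟩

theorem measurable_volume_slice {B : Set ℂ} (hB : MeasurableSet B) :
    Measurable fun s : ℝ => volume {y : ℝ | (⟨s, y⟩ : ℂ) ∈ B} :=
  measurable_measure_prodMk_left (ν := (volume : Measure ℝ))
    (Complex.measurableEquivRealProd.symm.measurable hB)

theorem lintegral_volume_slice {B : Set ℂ} (hB : MeasurableSet B) :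
    ∫⁻ s : ℝ, volume {y : ℝ | (⟨s, y⟩ : ℂ) ∈ B} = volume B := by
  rw [← Complex.volume_preserving_equiv_real_prod.symm.measure_preimage hB.nullMeasurableSet,
    Measure.volume_eq_prod, Measure.prod_apply (Complex.measurableEquivRealProd.symm.measurable hB)]
  rfl

/-- Near a regular point `z₀` of `v`, the map `Φ` whose real part is `v` divided by the length of
its gradient at `z₀`, and whose imaginary part is the linear coordinate along the level line, has
a rotation as its derivative; hence it is almost isometric and almost area preserving. It carries
the level sets of `v` to vertical lines, where the claim is Tonelli's theorem. -/
theorem exists_nhds_coarea_le {v : ℂ → ℝ} {L : ℂ →L[ℝ] ℝ} {z₀ : ℂ} (hv : HasStrictFDerivAt v L z₀)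
    (hL : L ≠ 0) {K : ℝ≥0} (hK : 1 < K) :
    ∃ N ∈ 𝓝 z₀, ∀ B ⊆ N, MeasurableSet B → ∃ φ : ℝ → ℝ≥0∞, Measurable φ ∧
      (∀ t, μH[1] (B ∩ v ⁻¹' {t}) ≤ φ t) ∧ ∫⁻ t, φ t ≤ K ^ 2 * ‖L‖ₑ * volume B := by
  set a : ℂ := ⟨L 1, L Complex.I⟩ with ha
  have hLa : ∀ z, L z = (starRingEnd ℂ a * z).re := by
    intro z
    have hz : z = z.re • (1 : ℂ) + z.im • Complex.I := by
      simp [Complex.re_add_im]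
    have h : L z = z.re • L 1 + z.im • L Complex.I := by
      rw [← map_smul, ← map_smul, ← map_add, ← hz]
    rw [h]
    simp [ha]; ring
  have ha0 : a ≠ 0 := by
    intro h
    apply hL
    ext; simp [hLa, h]
  set r : ℝ := ‖a‖ with hr
  have hr0 : 0 < r := norm_pos_iff.2 ha0
  have hrL : r ≤ ‖L‖ := by
    have h := L.le_opNorm a
    rw [hLa, ← Complex.normSq_eq_conj_mul_self, Complex.ofReal_re, Complex.normSq_eq_norm_sq,
      Real.norm_of_nonneg (by positivity)] at h
    nlinarith
  obtain ⟨c, hc⟩ : ∃ c : Circle, (c : ℂ) = starRingEnd ℂ a / r := by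
    refine ⟨⟨starRingEnd ℂ a / r, ?_⟩, rfl⟩
    rw [Submonoid.unitSphere, Submonoid.mem_mk, Subsemigroup.mem_mk, mem_sphere_zero_iff_norm, norm_div, RCLike.norm_conj, Complex.norm_real, Real.norm_of_nonneg hr0.le,
      div_self hr0.ne']
  set A : ℂ ≃L[ℝ] ℂ := (rotation c).toContinuousLinearEquiv with hA
  have hAz : ∀ z, A z = c * z := fun z => rfl
  have hAre : ∀ z, (A z).re = L z / r := by
    intro z
    rw [hAz, hc, hLa, div_mul_eq_mul_div, Complex.div_ofReal_re]
  set Φ : ℂ → ℂ := fun z => A z + ((v z / r - L z / r : ℝ) : ℂ) with hΦ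
  have hΦre : ∀ z, (Φ z).re = v z / r := by
    intro z
    simp [hΦ, hAre]
  have hΦd : HasStrictFDerivAt Φ (A : ℂ →L[ℝ] ℂ) z₀ := by
    have h1 : HasStrictFDerivAt (fun z => v z / r - L z / r) (0 : ℂ →L[ℝ] ℝ) z₀ := by
      have := (hv.sub L.hasStrictFDerivAt).mul_const r⁻¹
      simp only [sub_self, smul_zero] at this
      refine this.congr_of_eventuallyEq (Eventually.of_forall fun z => ?_)
      simp [div_eq_mul_inv, sub_mul]
    have h2 := (A : ℂ →L[ℝ] ℂ).hasStrictFDerivAt (x := z₀) |>.add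
      (Complex.ofRealCLM.hasStrictFDerivAt.comp z₀ h1)
    rw [ContinuousLinearMap.comp_zero, add_zero] at h2
    exact h2
  have hdet : ENNReal.ofReal |(A : ℂ →L[ℝ] ℂ).det| < K := by
    have : (A : ℂ →L[ℝ] ℂ).det = 1 := det_rotation c
    rw [this]
    simpa using hK
  -- With an error of at most `1 - K⁻¹`, `Φ` shrinks distances by at most the factor `K`.
  have hcpos : (0 : ℝ≥0) < 1 - K⁻¹ := by
    rw [tsub_pos_iff_lt]
    exact inv_lt_one_of_one_lt₀ hK
  obtain ⟨δ, hδ, hδ0, hδK⟩ := ((addHaar_image_le_mul_of_det_lt volume (A : ℂ →L[ℝ] ℂ) hdet).and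
    (Ioo_mem_nhdsGT hcpos)).exists
  obtain ⟨N, hN, happ⟩ := hΦd.approximates_deriv_on_nhds (c := δ) (Or.inr hδ0)
  refine ⟨N, hN, fun B hBN hB => ?_⟩
  have hanti : ∀ x ∈ N, ∀ y ∈ N, dist x y ≤ K * dist (Φ x) (Φ y) := by
    intro x hx y hy
    have h1 := happ x hx y hy
    have h2 : ‖A (x - y)‖ = ‖x - y‖ := (rotation c).norm_map _
    have h3 : ‖x - y‖ ≤ ‖Φ x - Φ y‖ + δ * ‖x - y‖ := by
      rw [← h2]
      calc ‖A (x - y)‖ = ‖(Φ x - Φ y) - (Φ x - Φ y - A (x - y))‖ := by congr 1; abel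
        _ ≤ _ := (norm_sub_le _ _).trans (by rw [h2]; gcongr; exact h1)
    have hδ' : (δ : ℝ) ≤ 1 - (K : ℝ)⁻¹ := by
      have := (NNReal.coe_lt_coe.2 hδK).le
      rwa [NNReal.coe_sub (inv_lt_one_of_one_lt₀ hK).le, NNReal.coe_one, NNReal.coe_inv] at this
    have hK0 : (0 : ℝ) < K := by exact_mod_cast zero_lt_one.trans hK
    rw [dist_eq_norm, dist_eq_norm]
    have h4 : (K : ℝ)⁻¹ * ‖x - y‖ ≤ ‖Φ x - Φ y‖ := by nlinarith [norm_nonneg (x - y)]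
    rwa [inv_mul_le_iff₀ hK0] at h4
  have hinj : InjOn Φ N := by
    intro x hx y hy hxy
    have := hanti x hx y hy
    rw [hxy, dist_self, mul_zero] at this
    exact dist_le_zero.1 this
  have hΦB : MeasurableSet (Φ '' B) :=
    hB.image_of_continuousOn_injOn (happ.continuousOn.mono hBN) (hinj.mono hBN)
  have hlip : LipschitzOnWith K (Function.invFunOn Φ N) (Φ '' N) := by
    refine LipschitzOnWith.of_dist_le_mul ?_
    rintro _ ⟨x, hx, rfl⟩ _ ⟨y, hy, rfl⟩
    rw [hinj.leftInvOn_invFunOn hx, hinj.leftInvOn_invFunOn hy]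
    exact hanti x hx y hy
  refine ⟨fun t => K * volume {y : ℝ | (⟨r⁻¹ * t, y⟩ : ℂ) ∈ Φ '' B},
    ((measurable_volume_slice hΦB).comp (measurable_const_mul _)).const_mul _, fun t => ?_, ?_⟩
  · beta_reduce
    rw [← hausdorffMeasure_one_inter_re_eq]
    have hsub : B ∩ v ⁻¹' {t} ⊆
        Function.invFunOn Φ N '' (Φ '' B ∩ {z | z.re = r⁻¹ * t}) := by
      rintro z ⟨hzB, hzt⟩
      refine ⟨Φ z, ⟨mem_image_of_mem _ hzB, ?_⟩, hinj.leftInvOn_invFunOn (hBN hzB)⟩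
      simp only [mem_ofPred_eq, hΦre]
      rw [show v z = t from hzt, div_eq_inv_mul]
    refine (measure_mono hsub).trans ?_
    have := (hlip.mono (inter_subset_left.trans (image_mono hBN) :
      Φ '' B ∩ {z | z.re = r⁻¹ * t} ⊆ Φ '' N)).hausdorffMeasure_image_le zero_le_one
    simpa using this
  · have hmeas := measurable_volume_slice hΦB
    have hscale : ∫⁻ t : ℝ, volume {y : ℝ | (⟨r⁻¹ * t, y⟩ : ℂ) ∈ Φ '' B} =
        ENNReal.ofReal r * volume (Φ '' B) := by
      rw [← lintegral_volume_slice hΦB,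
        ← lintegral_map (f := fun s : ℝ => volume {y : ℝ | (⟨s, y⟩ : ℂ) ∈ Φ '' B}) hmeas
          (measurable_const_mul r⁻¹), Real.map_volume_mul_left (inv_ne_zero hr0.ne'),
        lintegral_smul_measure, inv_inv, abs_of_pos hr0, smul_eq_mul]
    have hrL' : ENNReal.ofReal r ≤ ‖L‖ₑ := by
      rw [← ofReal_norm]
      exact ENNReal.ofReal_le_ofReal hrL
    rw [lintegral_const_mul' _ _ ENNReal.coe_ne_top, hscale]
    calc (K : ℝ≥0∞) * (ENNReal.ofReal r * volume (Φ '' B))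
        ≤ K * (‖L‖ₑ * (K * volume B)) := by
          gcongr
          exact hδ B Φ (happ.mono_set hBN)
      _ = _ := by ring

theorem exists_nhds_coarea_le_lintegral {U : Set ℂ} {v : ℂ → ℝ} (hU : IsOpen U)
    (hv : ContDiffOn ℝ 1 v U) {z₀ : ℂ} (hz₀ : z₀ ∈ U) (hd : fderiv ℝ v z₀ ≠ 0)
    {K : ℝ≥0} (hK : 1 < K) :
    ∃ N ∈ 𝓝 z₀, ∀ B ⊆ N, MeasurableSet B → ∃ φ : ℝ → ℝ≥0∞, Measurable φ ∧
      (∀ t, μH[1] (B ∩ v ⁻¹' {t}) ≤ φ t) ∧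
      ∫⁻ t, φ t ≤ K ^ 3 * ∫⁻ z in B, ‖fderiv ℝ v z‖ₑ := by
  have hcd : ContDiffAt ℝ 1 v z₀ := hv.contDiffAt (hU.mem_nhds hz₀)
  obtain ⟨N, hN, h⟩ := exists_nhds_coarea_le (hcd.hasStrictFDerivAt one_ne_zero) hd hK
  have hcont : ContinuousAt (fderiv ℝ v) z₀ :=
    (hcd.fderiv_right (m := 0) (by norm_num)).continuousAt
  have hpos : 0 < ‖fderiv ℝ v z₀‖ := norm_pos_iff.2 hd
  have hK0 : (0 : ℝ) < K := by exact_mod_cast zero_lt_one.trans hK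
  have hlt : (K : ℝ)⁻¹ * ‖fderiv ℝ v z₀‖ < ‖fderiv ℝ v z₀‖ :=
    mul_lt_of_lt_one_left hpos (inv_lt_one_of_one_lt₀ (by exact_mod_cast hK))
  have hev := hcont.norm.eventually (lt_mem_nhds hlt)
  refine ⟨_, inter_mem hN hev, fun B hB hBm => ?_⟩
  obtain ⟨φ, hφ, h1, h2⟩ := h B (hB.trans inter_subset_left) hBm
  refine ⟨φ, hφ, h1, h2.trans ?_⟩
  have h3 : ‖fderiv ℝ v z₀‖ₑ * volume B ≤ K * ∫⁻ z in B, ‖fderiv ℝ v z‖ₑ := by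
    rw [← setLIntegral_const, ← lintegral_const_mul' _ _ ENNReal.coe_ne_top]
    refine setLIntegral_mono' hBm fun z hz => ?_
    have h4 : (K : ℝ)⁻¹ * ‖fderiv ℝ v z₀‖ < ‖fderiv ℝ v z‖ := (hB hz).2
    rw [inv_mul_lt_iff₀ hK0] at h4
    rw [← ofReal_norm, ← ofReal_norm, ← ENNReal.ofReal_coe_nnreal,
      ← ENNReal.ofReal_mul hK0.le]
    exact ENNReal.ofReal_le_ofReal h4.le
  calc (K : ℝ≥0∞) ^ 2 * ‖fderiv ℝ v z₀‖ₑ * volume B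
      = K ^ 2 * (‖fderiv ℝ v z₀‖ₑ * volume B) := by ring
    _ ≤ K ^ 2 * (K * ∫⁻ z in B, ‖fderiv ℝ v z‖ₑ) := by gcongr
    _ = _ := by ring

theorem exists_coarea_le_of_measurableSet {U : Set ℂ} {v : ℂ → ℝ} (hU : IsOpen U)
    (hv : ContDiffOn ℝ 1 v U) (hd : ∀ z ∈ U, fderiv ℝ v z ≠ 0) {K : ℝ≥0} (hK : 1 < K)
    {B : Set ℂ} (hBU : B ⊆ U) (hB : MeasurableSet B) :
    ∃ φ : ℝ → ℝ≥0∞, Measurable φ ∧ (∀ t, μH[1] (B ∩ v ⁻¹' {t}) ≤ φ t) ∧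
      ∫⁻ t, φ t ≤ K ^ 3 * ∫⁻ z in B, ‖fderiv ℝ v z‖ₑ := by
  rcases U.eq_empty_or_nonempty with rfl | hne
  · obtain rfl : B = ∅ := subset_empty_iff.1 hBU
    exact ⟨0, measurable_zero, by simp, by simp⟩
  choose! N hN h using fun z hz => exists_nhds_coarea_le_lintegral hU hv hz (hd z hz) hK
  obtain ⟨T, hTU, hTc, hT⟩ := TopologicalSpace.countable_cover_nhdsWithin
    (f := fun z => interior (N z)) (s := U)
    fun z hz => mem_nhdsWithin_of_mem_nhds (interior_mem_nhds.2 (hN z hz))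
  have hTne : T.Nonempty := by
    obtain ⟨z, hz⟩ := hne
    obtain ⟨x, hx, -⟩ := mem_iUnion₂.1 (hT hz)
    exact ⟨x, hx⟩
  obtain ⟨e, rfl⟩ := hTc.exists_eq_range hTne
  set E : ℕ → Set ℂ := disjointed fun n => interior (N (e n)) with hE
  have hEm : ∀ n, MeasurableSet (E n) :=
    fun n => MeasurableSet.disjointed (fun n => isOpen_interior.measurableSet) n
  have hBE : B = ⋃ n, B ∩ E n := by
    rw [← inter_iUnion, hE, iUnion_disjointed, eq_comm, inter_eq_left]
    refine hBU.trans (hT.trans ?_)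
    simp
  have hloc : ∀ n, ∃ φ : ℝ → ℝ≥0∞, Measurable φ ∧
      (∀ t, μH[1] (B ∩ E n ∩ v ⁻¹' {t}) ≤ φ t) ∧
      ∫⁻ t, φ t ≤ K ^ 3 * ∫⁻ z in B ∩ E n, ‖fderiv ℝ v z‖ₑ := fun n =>
    h (e n) (hTU (mem_range_self n)) (B ∩ E n)
      (inter_subset_right.trans ((disjointed_subset _ n).trans interior_subset))
      (hB.inter (hEm n))
  choose φ hφ h1 h2 using hloc
  refine ⟨fun t => ∑' n, φ n t, Measurable.tsum hφ, fun t => ?_, ?_⟩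
  · calc μH[1] (B ∩ v ⁻¹' {t}) = μH[1] (⋃ n, B ∩ E n ∩ v ⁻¹' {t}) := by
          rw [← iUnion_inter, ← hBE]
      _ ≤ ∑' n, μH[1] (B ∩ E n ∩ v ⁻¹' {t}) := measure_iUnion_le _
      _ ≤ _ := ENNReal.tsum_le_tsum fun n => h1 n t
  · rw [lintegral_tsum fun n => (hφ n).aemeasurable]
    calc ∑' n, ∫⁻ t, φ n t ≤ ∑' n, K ^ 3 * ∫⁻ z in B ∩ E n, ‖fderiv ℝ v z‖ₑ :=
          ENNReal.tsum_le_tsum h2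
      _ = K ^ 3 * ∫⁻ z in ⋃ n, B ∩ E n, ‖fderiv ℝ v z‖ₑ := by
          rw [ENNReal.tsum_mul_left, lintegral_iUnion (fun n => hB.inter (hEm n))]
          exact fun i j hij => ((disjoint_disjointed _) hij).mono inter_subset_right
            inter_subset_right
      _ = _ := by rw [← hBE]

theorem exists_coarea_le_of_measurable {U : Set ℂ} {v : ℂ → ℝ} (hU : IsOpen U)
    (hv : ContDiffOn ℝ 1 v U) (hd : ∀ z ∈ U, fderiv ℝ v z ≠ 0) {K : ℝ≥0} (hK : 1 < K)
    {W : ℂ → ℝ≥0∞} (hW : Measurable W) :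
    ∃ φ : ℝ → ℝ≥0∞, Measurable φ ∧ (∀ t, ∫⁻ z in U ∩ v ⁻¹' {t}, W z ∂μH[1] ≤ φ t) ∧
      ∫⁻ t, φ t ≤ K ^ 3 * ∫⁻ z in U, W z * ‖fderiv ℝ v z‖ₑ := by
  have hDm : Measurable fun z => ‖fderiv ℝ v z‖ₑ := (measurable_fderiv ℝ v).enorm
  refine Measurable.ennreal_induction (motive := fun W : ℂ → ℝ≥0∞ =>
    ∃ φ : ℝ → ℝ≥0∞, Measurable φ ∧ (∀ t, ∫⁻ z in U ∩ v ⁻¹' {t}, W z ∂μH[1] ≤ φ t) ∧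
      ∫⁻ t, φ t ≤ K ^ 3 * ∫⁻ z in U, W z * ‖fderiv ℝ v z‖ₑ) ?_ ?_ ?_ hW
  · intro c s hs
    obtain ⟨φ, hφ, h1, h2⟩ := exists_coarea_le_of_measurableSet hU hv hd hK
      (inter_subset_left : U ∩ s ⊆ U) (hU.measurableSet.inter hs)
    refine ⟨fun t => c * φ t, hφ.const_mul c, fun t => ?_, ?_⟩
    · rw [lintegral_indicator_const hs, Measure.restrict_apply hs]
      refine mul_le_mul' le_rfl ((measure_mono ?_).trans (h1 t))
      rintro z ⟨hzs, hzU, hzt⟩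
      exact ⟨⟨hzU, hzs⟩, hzt⟩
    · rw [lintegral_const_mul _ hφ]
      have : ∀ z, s.indicator (fun _ => c) z * ‖fderiv ℝ v z‖ₑ =
          s.indicator (fun z => c * ‖fderiv ℝ v z‖ₑ) z := by
        intro z
        by_cases hz : z ∈ s <;> simp [hz]
      simp_rw [this]
      rw [lintegral_indicator hs, Measure.restrict_restrict hs, lintegral_const_mul _ hDm,
        inter_comm s U]
      calc c * ∫⁻ t, φ t ≤ c * (K ^ 3 * ∫⁻ z in U ∩ s, ‖fderiv ℝ v z‖ₑ) := by gcongr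
        _ = _ := by ring
  · intro f g _ hf hg ihf ihg
    obtain ⟨φ, hφ, h1, h2⟩ := ihf
    obtain ⟨ψ, hψ, h3, h4⟩ := ihg
    refine ⟨fun t => φ t + ψ t, hφ.add hψ, fun t => ?_, ?_⟩
    · simp only [Pi.add_apply]
      rw [lintegral_add_left hf]
      exact add_le_add (h1 t) (h3 t)
    · simp only [Pi.add_apply, add_mul]
      rw [lintegral_add_left hφ, lintegral_add_left (f := fun z => f z * ‖fderiv ℝ v z‖ₑ) (hf.mul hDm), mul_add]
      exact add_le_add h2 h4
  · intro f hf hmono ih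
    choose φ hφ h1 h2 using ih
    refine ⟨fun t => liminf (fun n => φ n t) atTop, Measurable.liminf hφ, fun t => ?_, ?_⟩
    -- The bounds `φ n` need not be monotone in `n`, so the limit inferior takes the place of the
    -- supremum.
    · rw [lintegral_iSup hf hmono]
      refine iSup_le fun n => ?_
      refine le_liminf_of_le (by isBoundedDefault) ?_
      filter_upwards [eventually_ge_atTop n] with k hk
      exact (lintegral_mono (hmono hk)).trans (h1 k t)
    · refine (lintegral_liminf_le hφ).trans ?_
      refine liminf_le_of_le (by isBoundedDefault) fun b hb => ?_
      obtain ⟨n, hn⟩ := hb.exists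
      refine (hn.trans (h2 n)).trans ?_
      gcongr with z
      exact le_iSup (fun n => f n z) n

/-- **Coarea inequality.** The integrals of `W` over the level sets of a regular function `v` are
dominated by a measurable function of the level, whose integral is at most `∫ W |∇v|`. The
dominating function is there because `W` may fail to be Borel measurable, so that its integrals
over curves may depend on the level in a non-measurable way. -/
theorem exists_coarea_le {U : Set ℂ} {v : ℂ → ℝ} (hU : IsOpen U)
    (hv : ContDiffOn ℝ 1 v U) (hd : ∀ z ∈ U, fderiv ℝ v z ≠ 0)
    {W : ℂ → ℝ≥0∞} (hW : AEMeasurable W (volume.restrict U)) :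
    ∃ φ : ℝ → ℝ≥0∞, Measurable φ ∧ (∀ t, ∫⁻ z in U ∩ v ⁻¹' {t}, W z ∂μH[1] ≤ φ t) ∧
      ∫⁻ t, φ t ≤ ∫⁻ z in U, W z * ‖fderiv ℝ v z‖ₑ := by
  classical
  -- A Borel majorant of `W` which agrees with `W` off a null set.
  obtain ⟨S, hS, hSm, hS0⟩ := exists_measurable_superset_of_null (ae_iff.1 hW.ae_eq_mk)
  set W' : ℂ → ℝ≥0∞ := S.piecewise (fun _ => ∞) (hW.mk W) with hW'
  have hW'm : Measurable W' := Measurable.piecewise hSm measurable_const hW.measurable_mk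
  have hle : ∀ z, W z ≤ W' z := by
    intro z
    by_cases hz : z ∈ S
    · simp [hW', hz]
    · have : W z = hW.mk W z := by
        by_contra h
        exact hz (hS h)
      simp [hW', hz, this]
  have hae : W' =ᵐ[volume.restrict U] W := by
    filter_upwards [hW.ae_eq_mk, measure_eq_zero_iff_ae_notMem.1 hS0] with z h1 h2
    simp [hW', h2, h1]
  have hint : ∫⁻ z in U, W' z * ‖fderiv ℝ v z‖ₑ = ∫⁻ z in U, W z * ‖fderiv ℝ v z‖ₑ :=
    lintegral_congr_ae (hae.mono fun z hz => by simp only [hz])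
  have hK : ∀ n : ℕ, (1 : ℝ≥0) < 1 + 1 / ((n : ℝ≥0) + 1) := fun n =>
    lt_add_of_pos_right _ (by positivity)
  choose φ hφ h1 h2 using fun n : ℕ => exists_coarea_le_of_measurable hU hv hd (hK n) hW'm
  refine ⟨fun t => liminf (fun n => φ n t) atTop, Measurable.liminf hφ, fun t => ?_, ?_⟩
  · refine (lintegral_mono hle).trans ?_
    exact le_liminf_of_le (by isBoundedDefault) (Eventually.of_forall fun n => h1 n t)
  · refine (lintegral_liminf_le hφ).trans ?_
    rw [← hint]
    have hlim : Tendsto (fun n : ℕ => ((1 + 1 / ((n : ℝ≥0) + 1) : ℝ≥0) : ℝ≥0∞) ^ 3 *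
        ∫⁻ z in U, W' z * ‖fderiv ℝ v z‖ₑ) atTop (𝓝 (∫⁻ z in U, W' z * ‖fderiv ℝ v z‖ₑ)) := by
      have h3 : Tendsto (fun n : ℕ => (1 + 1 / ((n : ℝ≥0) + 1) : ℝ≥0)) atTop (𝓝 1) := by
        simpa using tendsto_const_nhds.add (tendsto_one_div_add_atTop_nhds_zero_nat (𝕜 := ℝ≥0))
      have h4 := ENNReal.Tendsto.mul_const (b := ∫⁻ z in U, W' z * ‖fderiv ℝ v z‖ₑ)
        (ENNReal.Tendsto.pow (n := 3) (ENNReal.tendsto_coe.2 h3)) (Or.inl (by simp))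
      simpa using h4
    rw [← hlim.liminf_eq]
    exact liminf_le_liminf (Eventually.of_forall h2)

/-! ### Superlevel sets and the Cheeger constant -/

/-- `v` is continuous on `D`, and smooth with non-vanishing differential on the open subset `R`,
which contains all but countably many of the level sets of `v` in `D`. -/
structure IsRegularOff (D R : Set ℂ) (v : ℂ → ℝ) : Prop where
  continuousOn : ContinuousOn v D
  subset : R ⊆ D
  isOpen : IsOpen R
  contDiffOn : ContDiffOn ℝ ∞ v R
  fderiv_ne_zero : ∀ z ∈ R, fderiv ℝ v z ≠ 0
  countable : (v '' (D \ R)).Countable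

theorem IsRegularOff.neg {D R : Set ℂ} {v : ℂ → ℝ} (h : IsRegularOff D R v) :
    IsRegularOff D R (fun z => -v z) where
  continuousOn := h.continuousOn.neg
  subset := h.subset
  isOpen := h.isOpen
  contDiffOn := h.contDiffOn.neg
  fderiv_ne_zero z hz := by
    rw [fderiv_fun_neg]
    exact neg_ne_zero.2 (h.fderiv_ne_zero z hz)
  countable := by
    have : (fun z => -v z) '' (D \ R) = (fun x => -x) '' (v '' (D \ R)) := by
      rw [image_image]
    rw [this]
    exact h.countable.image _

theorem weightedMeasure_compl {D : Set ℂ} (hD : IsOpen D) (w : ℂ → ℝ) :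
    weightedMeasure D w Dᶜ = 0 := by
  refine withDensity_absolutelyContinuous _ _ ?_
  simp [Measure.restrict_apply hD.measurableSet.compl]

theorem ae_mem_weightedMeasure {D : Set ℂ} (hD : IsOpen D) (w : ℂ → ℝ) :
    ∀ᵐ z ∂weightedMeasure D w, z ∈ D :=
  weightedMeasure_compl hD w

theorem IsRegularOff.aemeasurable {D R : Set ℂ} {v : ℂ → ℝ} (h : IsRegularOff D R v)
    (hD : IsOpen D) (w : ℂ → ℝ) : AEMeasurable v (weightedMeasure D w) :=
  (h.continuousOn.aemeasurable hD.measurableSet).mono_ac (withDensity_absolutelyContinuous _ _)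

/-- The superlevel set at a level `t` outside the countable exceptional set is a competitor for the
Cheeger constant: its relative boundary is the level set of `t`, as `v` has no local maximum
there. -/
theorem IsRegularOff.cheegerConstant_mul_le {D R : Set ℂ} {v : ℂ → ℝ} (h : IsRegularOff D R v)
    (hD : IsOpen D) {w : ℂ → ℝ} {t : ℝ} (ht : t ∉ v '' (D \ R))
    (hmed : weightedMeasure D w (D ∩ {z | t < v z}) ≤ weightedMeasure D w D / 2) :
    cheegerConstant D w * weightedMeasure D w (D ∩ {z | t < v z}) ≤
      weightedLength w (R ∩ v ⁻¹' {t}) := by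
  set C := D ∩ {z | t < v z} with hC
  rcases eq_zero_or_pos (weightedMeasure D w C) with h0 | hpos
  · simp [h0]
  have hCo : IsOpen C := h.continuousOn.isOpen_inter_preimage hD isOpen_Ioi
  have hfr : frontier C ∩ D = R ∩ v ⁻¹' {t} := by
    ext z
    rw [hCo.frontier_eq]
    constructor
    · rintro ⟨⟨hzc, hzC⟩, hzD⟩
      have hle : v z ≤ t := by
        by_contra hlt
        exact hzC ⟨hzD, not_le.1 hlt⟩
      have hge : t ≤ v z := by
        by_contra hlt
        have hev := (h.continuousOn.continuousAt (hD.mem_nhds hzD)).eventually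
          (gt_mem_nhds (not_le.1 hlt))
        obtain ⟨y, hyC, hy⟩ := ((mem_closure_iff_frequently.1 hzc).and_eventually hev).exists
        exact lt_asymm hy hyC.2
      have hvt : v z = t := le_antisymm hle hge
      refine ⟨?_, hvt⟩
      by_contra hzR
      exact ht ⟨z, ⟨hzD, hzR⟩, hvt⟩
    · rintro ⟨hzR, hvt⟩
      have hvt : v z = t := hvt
      have hzD := h.subset hzR
      refine ⟨⟨?_, fun hzC => hzC.2.ne' hvt⟩, hzD⟩
      by_contra hzc
      refine h.fderiv_ne_zero z hzR (IsLocalMax.fderiv_eq_zero ?_)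
      rw [mem_closure_iff_frequently, not_frequently] at hzc
      filter_upwards [hzc, hD.mem_nhds hzD] with y hyC hyD
      by_contra hlt
      exact hyC ⟨hyD, hvt ▸ not_le.1 hlt⟩
  have hcomp : IsCheegerCompetitor D w C := by
    refine ⟨inter_subset_left, hCo, ?_, hpos, hmed⟩
    rw [hfr]
    rintro z ⟨hzR, -⟩
    refine ⟨R, fun y => v y - t, h.isOpen, hzR, h.contDiffOn.sub contDiffOn_const, ?_, ?_⟩
    · intro y hy
      rw [fderiv_sub_const]
      exact h.fderiv_ne_zero y hy
    · intro y hy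
      rw [sub_eq_zero]
      exact ⟨fun hyt => hyt.2, fun hyt => ⟨hy, hyt⟩⟩
  refine ENNReal.mul_le_of_le_div ?_
  rw [← hfr]
  exact iInf₂_le C hcomp

/-- The Cheeger inequality for the levels above a median, integrated against `p s ^ (p - 1) ds`:
layer cake formula on the left, coarea inequality on the right. -/
theorem IsRegularOff.cheegerConstant_mul_lintegral_posPart_le {D R : Set ℂ} {v : ℂ → ℝ}
    (h : IsRegularOff D R v) (hD : IsOpen D) {w : ℂ → ℝ}
    (hw : AEMeasurable w (volume.restrict D)) {p : ℝ} (hp : 1 ≤ p) {m : ℝ}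
    (hmed : weightedMeasure D w (D ∩ {z | m < v z}) ≤ weightedMeasure D w D / 2) :
    cheegerConstant D w * ∫⁻ z, ENNReal.ofReal (max (v z - m) 0 ^ p) ∂weightedMeasure D w ≤
      ∫⁻ z in R ∩ {z | m < v z}, ENNReal.ofReal (p * (v z - m) ^ (p - 1)) * ‖fderiv ℝ v z‖ₑ
        ∂weightedMeasure D w := by
  set μ := weightedMeasure D w with hμ
  set A := R ∩ {z | m < v z} with hA
  have hp0 : 0 < p := zero_lt_one.trans_le hp
  have hvR : ContinuousOn v R := h.continuousOn.mono h.subset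
  have hAo : IsOpen A := hvR.isOpen_inter_preimage h.isOpen isOpen_Ioi
  have hAD : A ⊆ D := inter_subset_left.trans h.subset
  have hwA : AEMeasurable w (volume.restrict A) := hw.mono_measure (Measure.restrict_mono hAD le_rfl)
  have hvA : AEMeasurable v (volume.restrict A) :=
    (hvR.mono inter_subset_left).aemeasurable hAo.measurableSet
  set ρ : ℂ → ℝ≥0∞ := fun z => ENNReal.ofReal (p * (v z - m) ^ (p - 1)) with hρ
  have hρA : AEMeasurable ρ (volume.restrict A) :=
    (((hvA.sub_const m).pow_const (p - 1)).const_mul p).ennreal_ofReal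
  obtain ⟨φ, hφ, h1, h2⟩ := exists_coarea_le hAo
    ((h.contDiffOn.mono inter_subset_left).of_le (by exact_mod_cast le_top))
    (fun z hz => h.fderiv_ne_zero z hz.1) (hρA.mul hwA.ennreal_ofReal)
  have hRHS : ∫⁻ z in A, ρ z * ‖fderiv ℝ v z‖ₑ ∂μ =
      ∫⁻ z in A, (ρ * fun z => ENNReal.ofReal (w z)) z * ‖fderiv ℝ v z‖ₑ := by
    rw [hμ, weightedMeasure, restrict_withDensity hAo.measurableSet,
      Measure.restrict_restrict hAo.measurableSet, inter_eq_self_of_subset_left hAD,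
      lintegral_withDensity_eq_lintegral_mul₀ (g := fun z => ρ z * ‖fderiv ℝ v z‖ₑ)
        hwA.ennreal_ofReal (hρA.mul (measurable_fderiv ℝ v).enorm.aemeasurable)]
    refine lintegral_congr fun z => ?_
    simp only [Pi.mul_apply]
    ring
  rw [hRHS]
  refine le_trans ?_ h2
  rw [lintegral_rpow_eq_lintegral_meas_lt_mul μ (f := fun z => max (v z - m) 0) (Eventually.of_forall fun z => le_max_right _ _)
    (((h.aemeasurable hD w).sub_const m).max aemeasurable_const) hp0]
  have hlevel : ∀ᵐ s ∂(volume.restrict (Ioi (0 : ℝ))),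
      cheegerConstant D w * (ENNReal.ofReal p *
        (μ {a | s < max (v a - m) 0} * ENNReal.ofReal (s ^ (p - 1)))) ≤ φ (m + s) := by
    have hc : ∀ᵐ s : ℝ, m + s ∉ v '' (D \ R) := by
      have hc : ((fun s => m + s) ⁻¹' (v '' (D \ R))).Countable :=
        h.countable.preimage (add_right_injective m)
      exact measure_eq_zero_iff_ae_notMem.1 (hc.measure_zero volume)
    filter_upwards [ae_restrict_of_ae hc, ae_restrict_mem measurableSet_Ioi] with s hs hs0
    have hs0 : 0 < s := hs0
    have hset : μ {a | s < max (v a - m) 0} = μ (D ∩ {z | m + s < v z}) := by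
      refine measure_congr ?_
      filter_upwards [ae_mem_weightedMeasure hD w] with z hz
      refine propext ?_
      change s < max (v z - m) 0 ↔ z ∈ D ∧ m + s < v z
      rw [lt_max_iff, lt_sub_iff_add_lt']
      exact ⟨fun h => ⟨hz, h.resolve_right hs0.not_gt⟩, fun h => Or.inl h.2⟩
    have hle := h.cheegerConstant_mul_le hD hs (w := w) <| (measure_mono
      (inter_subset_inter_right D fun z (hz : m + s < v z) =>
        (show m < v z by linarith))).trans hmed
    rw [hset]
    calc cheegerConstant D w * (ENNReal.ofReal p *
          (μ (D ∩ {z | m + s < v z}) * ENNReal.ofReal (s ^ (p - 1))))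
        = ENNReal.ofReal (p * s ^ (p - 1)) *
          (cheegerConstant D w * μ (D ∩ {z | m + s < v z})) := by
          rw [ENNReal.ofReal_mul hp0.le]; ring
      _ ≤ ENNReal.ofReal (p * s ^ (p - 1)) * weightedLength w (R ∩ v ⁻¹' {m + s}) := by gcongr
      _ = ∫⁻ z in A ∩ v ⁻¹' {m + s}, (ρ * fun z => ENNReal.ofReal (w z)) z ∂μH[1] := by
          have hAR : A ∩ v ⁻¹' {m + s} = R ∩ v ⁻¹' {m + s} := by
            ext z
            constructor
            · rintro ⟨⟨hzR, -⟩, hzs⟩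
              exact ⟨hzR, hzs⟩
            · rintro ⟨hzR, hzs⟩
              have hzs' : v z = m + s := hzs
              exact ⟨⟨hzR, show m < v z by linarith⟩, hzs⟩
          have hmeas : MeasurableSet (R ∩ v ⁻¹' {m + s}) := by
            obtain ⟨F, hF, hF'⟩ := (continuousOn_iff_isClosed.1 hvR) {m + s} isClosed_singleton
            rw [inter_comm, hF']
            exact hF.measurableSet.inter h.isOpen.measurableSet
          rw [hAR, weightedLength, ← lintegral_const_mul' _ _ ENNReal.ofReal_ne_top]
          refine setLIntegral_congr_fun hmeas fun z hz => ?_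
          have hzs : v z = m + s := hz.2
          simp [hρ, hzs]
      _ ≤ φ (m + s) := h1 _
  calc cheegerConstant D w * (ENNReal.ofReal p *
        ∫⁻ s in Ioi 0, μ {a | s < max (v a - m) 0} * ENNReal.ofReal (s ^ (p - 1)))
      ≤ ∫⁻ s in Ioi 0, cheegerConstant D w * (ENNReal.ofReal p *
        (μ {a | s < max (v a - m) 0} * ENNReal.ofReal (s ^ (p - 1)))) := by
        rw [← lintegral_const_mul' _ _ ENNReal.ofReal_ne_top]
        exact lintegral_const_mul_le _ _
    _ ≤ ∫⁻ s in Ioi 0, φ (m + s) := lintegral_mono_ae hlevel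
    _ ≤ ∫⁻ s, φ (m + s) := setLIntegral_le_lintegral _ _
    _ = ∫⁻ t, φ t := lintegral_add_left_eq_self φ m

theorem exists_median {D R : Set ℂ} {v : ℂ → ℝ} (h : IsRegularOff D R v) (hD : IsOpen D)
    (μ : Measure ℂ) [IsFiniteMeasure μ] {M : ℝ} (hM : ∀ z ∈ D, |v z| ≤ M) :
    ∃ m : ℝ, μ (D ∩ {z | m < v z}) ≤ μ D / 2 ∧ μ (D ∩ {z | v z < m}) ≤ μ D / 2 := by
  rcases eq_or_ne (μ D) 0 with h0 | h0
  · exact ⟨0, (measure_mono_null inter_subset_left h0).trans_le zero_le,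
      (measure_mono_null inter_subset_left h0).trans_le zero_le⟩
  set S : Set ℝ := {t | μ (D ∩ {z | t < v z}) ≤ μ D / 2} with hS
  have hMS : M ∈ S := by
    have : D ∩ {z | M < v z} = ∅ := by
      ext z
      simp only [mem_inter_iff, mem_ofPred_eq, mem_empty_iff_false, iff_false, not_and, not_lt]
      exact fun hz => (abs_le.1 (hM z hz)).2
    simp [hS, this]
  have hbdd : BddBelow S := by
    refine ⟨-M, fun t ht => ?_⟩
    by_contra hlt
    have : D ∩ {z | t < v z} = D := inter_eq_left.2 fun z hz =>
      (not_le.1 hlt).trans_le (abs_le.1 (hM z hz)).1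
    have ht' : μ D ≤ μ D / 2 := by
      have := ht
      rwa [hS, mem_ofPred_eq, ‹D ∩ {z | t < v z} = D›] at this
    exact (ENNReal.half_lt_self h0 (measure_ne_top μ D)).not_ge ht'
  have hup : ∀ t, sInf S < t → μ (D ∩ {z | t < v z}) ≤ μ D / 2 := by
    intro t ht
    obtain ⟨s, hs, hst⟩ := exists_lt_of_csInf_lt ⟨M, hMS⟩ ht
    exact (measure_mono (inter_subset_inter_right D fun z (hz : t < v z) => hst.trans hz)).trans hs
  have hlow : ∀ t, t < sInf S → μ (D ∩ {z | v z < t}) ≤ μ D / 2 := by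
    intro t ht
    have htS : μ D / 2 < μ (D ∩ {z | t < v z}) := not_le.1 fun hle => (csInf_le hbdd hle).not_gt ht
    have hdisj : Disjoint (D ∩ {z | v z < t}) (D ∩ {z | t < v z}) :=
      disjoint_left.2 fun z hz hz' => lt_asymm (show v z < t from hz.2) hz'.2
    have hm : MeasurableSet (D ∩ {z | t < v z}) :=
      (h.continuousOn.isOpen_inter_preimage hD isOpen_Ioi).measurableSet
    have hsum : μ (D ∩ {z | v z < t}) + μ (D ∩ {z | t < v z}) ≤ μ D := by
      rw [← measure_union hdisj hm]
      exact measure_mono (union_subset inter_subset_left inter_subset_left)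
    by_contra hgt
    have := ENNReal.add_lt_add (not_le.1 hgt) htS
    rw [ENNReal.add_halves] at this
    exact this.not_ge hsum
  refine ⟨sInf S, ?_, ?_⟩
  · have hU : D ∩ {z | sInf S < v z} = ⋃ n : ℕ, D ∩ {z | sInf S + 1 / ((n : ℝ) + 1) < v z} := by
      rw [← inter_iUnion]
      congr 1
      ext z
      simp only [mem_ofPred_eq, mem_iUnion]
      constructor
      · intro hz
        obtain ⟨n, hn⟩ := exists_nat_one_div_lt (sub_pos.2 hz)
        exact ⟨n, by linarith⟩
      · rintro ⟨n, hn⟩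
        have : (0 : ℝ) < 1 / ((n : ℝ) + 1) := by positivity
        linarith
    have hmono : Monotone fun n : ℕ => D ∩ {z | sInf S + 1 / ((n : ℝ) + 1) < v z} := by
      refine fun i j hij => inter_subset_inter_right D fun z hz => ?_
      have hz : sInf S + 1 / ((i : ℝ) + 1) < v z := hz
      exact lt_of_le_of_lt (by gcongr) hz
    rw [hU, hmono.measure_iUnion]
    exact iSup_le fun n => hup _ (lt_add_of_pos_right _ (by positivity))
  · have hU : D ∩ {z | v z < sInf S} = ⋃ n : ℕ, D ∩ {z | v z < sInf S - 1 / ((n : ℝ) + 1)} := by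
      rw [← inter_iUnion]
      congr 1
      ext z
      simp only [mem_ofPred_eq, mem_iUnion]
      constructor
      · intro hz
        obtain ⟨n, hn⟩ := exists_nat_one_div_lt (sub_pos.2 hz)
        exact ⟨n, by linarith⟩
      · rintro ⟨n, hn⟩
        have : (0 : ℝ) < 1 / ((n : ℝ) + 1) := by positivity
        linarith
    have hmono : Monotone fun n : ℕ => D ∩ {z | v z < sInf S - 1 / ((n : ℝ) + 1)} := by
      refine fun i j hij => inter_subset_inter_right D fun z hz => ?_
      have hz : v z < sInf S - 1 / ((i : ℝ) + 1) := hz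
      exact lt_of_lt_of_le hz (by gcongr)
    rw [hU, hmono.measure_iUnion]
    exact iSup_le fun n => hlow _ (sub_lt_self _ (by positivity))

/-- The Cheeger inequality in `L^p` about a median. -/
theorem IsRegularOff.exists_cheegerConstant_mul_eLpNorm_sub_le {D R : Set ℂ} {v : ℂ → ℝ}
    (h : IsRegularOff D R v) (hD : IsOpen D) {w : ℂ → ℝ}
    (hw : AEMeasurable w (volume.restrict D)) [IsFiniteMeasure (weightedMeasure D w)]
    {p : ℝ} (hp : 1 ≤ p) {M : ℝ} (hM : ∀ z ∈ D, |v z| ≤ M) {Γ : ℂ → ℝ}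
    (hΓm : AEStronglyMeasurable Γ (weightedMeasure D w))
    (hΓ : ∀ᵐ z ∂weightedMeasure D w, z ∈ R → ‖fderiv ℝ v z‖ₑ ≤ ‖Γ z‖ₑ) :
    ∃ m : ℝ, cheegerConstant D w *
        eLpNorm (fun z => v z - m) (ENNReal.ofReal p) (weightedMeasure D w) ≤
      ENNReal.ofReal p * eLpNorm Γ (ENNReal.ofReal p) (weightedMeasure D w) := by
  set μ := weightedMeasure D w with hμ
  have hp0 : 0 < p := zero_lt_one.trans_le hp
  obtain ⟨m, hm1, hm2⟩ := exists_median h hD μ hM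
  refine ⟨m, ?_⟩
  have hvm : AEMeasurable v μ := h.aemeasurable hD w
  have hvR : ContinuousOn v R := h.continuousOn.mono h.subset
  set X := ∫⁻ z, ‖v z - m‖ₑ ^ p ∂μ with hX
  set Y := ∫⁻ z, ‖Γ z‖ₑ ^ p ∂μ with hY
  have hm2' : μ (D ∩ {z | -m < -v z}) ≤ μ D / 2 := by simpa using hm2
  have h1 := h.cheegerConstant_mul_lintegral_posPart_le hD hw hp hm1
  have h2 := h.neg.cheegerConstant_mul_lintegral_posPart_le hD hw hp hm2'
  have hP : ∀ x : ℝ, ‖x‖ₑ ^ p ≤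
      ENNReal.ofReal (max x 0 ^ p) + ENNReal.ofReal (max (-x) 0 ^ p) := by
    intro x
    rw [← ofReal_norm, ENNReal.ofReal_rpow_of_nonneg (norm_nonneg x) hp0.le, Real.norm_eq_abs]
    rcases le_total 0 x with hx | hx
    · rw [abs_of_nonneg hx, max_eq_left hx]
      exact le_self_add
    · rw [abs_of_nonpos hx, max_eq_left (neg_nonneg.2 hx)]
      exact le_add_self
  have hQ : ∀ x : ℝ, 0 < x → ENNReal.ofReal (p * x ^ (p - 1)) =
      ENNReal.ofReal p * ‖x‖ₑ ^ (p - 1) := by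
    intro x hx
    rw [← ofReal_norm, ENNReal.ofReal_rpow_of_nonneg (norm_nonneg x) (by linarith),
      ENNReal.ofReal_mul hp0.le, Real.norm_of_nonneg hx.le]
  have hsum : cheegerConstant D w * X ≤
      ENNReal.ofReal p * ∫⁻ z, ‖Γ z‖ₑ * ‖v z - m‖ₑ ^ (p - 1) ∂μ := by
    set G : ℂ → ℝ≥0∞ := fun z => ENNReal.ofReal p * (‖Γ z‖ₑ * ‖v z - m‖ₑ ^ (p - 1)) with hG
    have hA1 : MeasurableSet (R ∩ {z | m < v z}) :=
      (hvR.isOpen_inter_preimage h.isOpen isOpen_Ioi).measurableSet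
    have hA2 : MeasurableSet (R ∩ {z | -m < -v z}) :=
      (hvR.neg.isOpen_inter_preimage h.isOpen isOpen_Ioi).measurableSet
    have h1' : ∫⁻ z in R ∩ {z | m < v z}, ENNReal.ofReal (p * (v z - m) ^ (p - 1)) *
        ‖fderiv ℝ v z‖ₑ ∂μ ≤ ∫⁻ z in R ∩ {z | m < v z}, G z ∂μ := by
      refine lintegral_mono_ae ?_
      filter_upwards [ae_restrict_of_ae hΓ, ae_restrict_mem hA1] with z hz hzA
      have hzA2 : m < v z := hzA.2
      rw [hQ _ (sub_pos.2 hzA2), mul_assoc]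
      refine mul_le_mul' le_rfl ?_
      rw [mul_comm]
      exact mul_le_mul' (hz hzA.1) le_rfl
    have h2' : ∫⁻ z in R ∩ {z | -m < -v z}, ENNReal.ofReal (p * (-v z - -m) ^ (p - 1)) *
        ‖fderiv ℝ (fun z => -v z) z‖ₑ ∂μ ≤ ∫⁻ z in R ∩ {z | -m < -v z}, G z ∂μ := by
      refine lintegral_mono_ae ?_
      filter_upwards [ae_restrict_of_ae hΓ, ae_restrict_mem hA2] with z hz hzA
      have hzA2 : -m < -v z := hzA.2
      rw [hQ _ (sub_pos.2 hzA2), mul_assoc, fderiv_fun_neg, enorm_neg,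
        show -v z - -m = -(v z - m) by ring, enorm_neg]
      refine mul_le_mul' le_rfl ?_
      rw [mul_comm]
      exact mul_le_mul' (hz hzA.1) le_rfl
    have hdisj : Disjoint (R ∩ {z | m < v z}) (R ∩ {z | -m < -v z}) :=
      disjoint_left.2 fun z hz hz' =>
        lt_asymm (show m < v z from hz.2) (neg_lt_neg_iff.1 (show -m < -v z from hz'.2))
    calc cheegerConstant D w * X
        ≤ cheegerConstant D w * (∫⁻ z, ENNReal.ofReal (max (v z - m) 0 ^ p) ∂μ +
            ∫⁻ z, ENNReal.ofReal (max (-v z - -m) 0 ^ p) ∂μ) := by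
          gcongr
          rw [← lintegral_add_left' ((((hvm.sub_const m).max aemeasurable_const).pow_const
            p).ennreal_ofReal)]
          refine lintegral_mono fun z => ?_
          rw [show -v z - -m = -(v z - m) by ring]
          exact hP _
      _ ≤ ∫⁻ z in R ∩ {z | m < v z}, G z ∂μ + ∫⁻ z in R ∩ {z | -m < -v z}, G z ∂μ := by
          rw [mul_add]
          exact add_le_add (h1.trans h1') (h2.trans h2')
      _ ≤ ∫⁻ z, G z ∂μ := by
          rw [← lintegral_union hA2 hdisj]
          exact setLIntegral_le_lintegral _ _
      _ = _ := lintegral_const_mul' _ _ ENNReal.ofReal_ne_top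
  -- Finiteness of `X` is what allows `X ^ (1 / q)` to be cancelled after Hölder's inequality.
  have hXfin : X ≠ ⊤ := by
    have hbd : ∀ᵐ z ∂μ, ‖v z - m‖ₑ ^ p ≤ ENNReal.ofReal (M + |m|) ^ p := by
      filter_upwards [ae_mem_weightedMeasure hD w] with z hz
      rw [← ofReal_norm]
      gcongr
      exact (norm_sub_le _ _).trans (add_le_add (hM z hz) le_rfl)
    refine ((lintegral_mono_ae hbd).trans_lt ?_).ne
    rw [lintegral_const]
    exact ENNReal.mul_lt_top (ENNReal.rpow_lt_top_of_nonneg hp0.le ENNReal.ofReal_ne_top)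
      (measure_lt_top _ _)
  have hpne : ENNReal.ofReal p ≠ 0 := by simpa using hp0
  rw [eLpNorm_eq_lintegral_rpow_enorm_toReal hpne ENNReal.ofReal_ne_top,
    eLpNorm_eq_lintegral_rpow_enorm_toReal hpne ENNReal.ofReal_ne_top,
    ENNReal.toReal_ofReal hp0.le]
  change cheegerConstant D w * X ^ (1 / p) ≤ ENNReal.ofReal p * Y ^ (1 / p)
  rcases eq_or_ne X 0 with hX0 | hX0
  · rw [hX0, ENNReal.zero_rpow_of_pos (by positivity), mul_zero]
    exact zero_le
  rcases eq_or_lt_of_le hp with rfl | hp1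
  · have hsum' := hsum
    simp only [sub_self, ENNReal.rpow_zero, mul_one] at hsum'
    simpa [hY] using hsum'
  · have hpq := Real.HolderConjugate.conjExponent hp1
    set q := p.conjExponent with hq
    have hHol := ENNReal.lintegral_mul_rpow_le_lintegral_rpow_mul_lintegral_rpow (μ := μ) hpq
      (f := fun z => ‖Γ z‖ₑ) (g := fun z => ‖v z - m‖ₑ) hΓm.enorm (hvm.sub_const m).enorm
    have hq0 : X ^ (1 / q) ≠ 0 := by
      exact (ENNReal.rpow_pos (pos_iff_ne_zero.2 hX0) hXfin).ne'
    have hqt : X ^ (1 / q) ≠ ⊤ := by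
      refine ENNReal.rpow_ne_top_of_nonneg (one_div_nonneg.2 hpq.symm.nonneg) hXfin
    have hXX : X = X ^ (1 / p) * X ^ (1 / q) := by
      rw [← ENNReal.rpow_add _ _ hX0 hXfin, one_div, one_div, hpq.inv_add_inv_eq_one,
        ENNReal.rpow_one]
    refine (ENNReal.mul_le_mul_iff_left hq0 hqt).1 ?_
    calc cheegerConstant D w * X ^ (1 / p) * X ^ (1 / q)
        = cheegerConstant D w * X := by rw [mul_assoc, ← hXX]
      _ ≤ ENNReal.ofReal p * (Y ^ (1 / p) * X ^ (1 / q)) := hsum.trans (by gcongr)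
      _ = _ := by rw [mul_assoc]

/-! ### Compactified real part of a meromorphic function -/

/-- The function `ζ ↦ Re ζ / (1 + ε |ζ|²)`. Up to scaling this is a coordinate function of the
Riemann sphere under stereographic projection, so it extends continuously to `∞` by `0`, and its
only critical points are `± 1 / √ε`. -/
noncomputable def sphericalRe (ε : ℝ) (ζ : ℂ) : ℝ := ζ.re / (1 + ε * (ζ.re ^ 2 + ζ.im ^ 2))

section sphericalRe

variable {ε : ℝ}

theorem sphericalRe_denom_pos (hε : 0 < ε) (ζ : ℂ) : 0 < 1 + ε * (ζ.re ^ 2 + ζ.im ^ 2) := by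
  positivity

theorem contDiff_sphericalRe (hε : 0 < ε) : ContDiff ℝ ∞ (sphericalRe ε) := by
  have hre : ContDiff ℝ ∞ (fun ζ : ℂ => ζ.re) := Complex.reCLM.contDiff
  have him : ContDiff ℝ ∞ (fun ζ : ℂ => ζ.im) := Complex.imCLM.contDiff
  exact hre.div (contDiff_const.add (contDiff_const.mul ((hre.pow 2).add (him.pow 2))))
    fun ζ => (sphericalRe_denom_pos hε ζ).ne'

theorem fderiv_sphericalRe_apply (hε : 0 < ε) (ζ k : ℂ) :
    fderiv ℝ (sphericalRe ε) ζ k =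
      (k.re * (1 + ε * (ζ.re ^ 2 + ζ.im ^ 2)) - ζ.re * (2 * ε * (ζ.re * k.re + ζ.im * k.im))) /
        (1 + ε * (ζ.re ^ 2 + ζ.im ^ 2)) ^ 2 := by
  have hline : HasDerivAt (fun t : ℝ => ζ + t • k) k 0 := by
    simpa using ((hasDerivAt_id (0 : ℝ)).smul_const k).const_add ζ
  have h1 : HasDerivAt (fun t : ℝ => sphericalRe ε (ζ + t • k)) (fderiv ℝ (sphericalRe ε) ζ k) 0 := by
    have hd : HasFDerivAt (sphericalRe ε) (fderiv ℝ (sphericalRe ε) ζ) (ζ + (0 : ℝ) • k) := by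
      simpa using ((contDiff_sphericalRe hε).differentiable (by simp) ζ).hasFDerivAt
    exact hd.comp_hasDerivAt 0 hline
  have hre : HasDerivAt (fun t : ℝ => (ζ + t • k).re) k.re 0 :=
    Complex.reCLM.hasFDerivAt.comp_hasDerivAt 0 hline
  have him : HasDerivAt (fun t : ℝ => (ζ + t • k).im) k.im 0 :=
    Complex.imCLM.hasFDerivAt.comp_hasDerivAt 0 hline
  have h2 := hre.div ((((hre.pow 2).add (him.pow 2)).const_mul ε).const_add 1)
    (by simpa using (sphericalRe_denom_pos hε ζ).ne')
  refine (h1.unique h2).trans ?_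
  simp
  ring

theorem norm_fderiv_sphericalRe_le (hε : 0 < ε) (ζ : ℂ) :
    ‖fderiv ℝ (sphericalRe ε) ζ‖ ≤ 1 := by
  refine ContinuousLinearMap.opNorm_le_bound _ zero_le_one fun k => ?_
  have hN := sphericalRe_denom_pos hε ζ
  set N := 1 + ε * (ζ.re ^ 2 + ζ.im ^ 2) with hNdef
  have hN1 : 1 ≤ N := by
    have : 0 ≤ ε * (ζ.re ^ 2 + ζ.im ^ 2) := by positivity
    linarith
  rw [fderiv_sphericalRe_apply hε, one_mul, Real.norm_eq_abs, abs_div, abs_of_pos (pow_pos hN 2),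
    div_le_iff₀ (pow_pos hN 2)]
  have hk : ‖k‖ ^ 2 = k.re ^ 2 + k.im ^ 2 := by
    rw [← Complex.normSq_eq_norm_sq, Complex.normSq_apply]; ring
  refine abs_le_of_sq_le_sq ?_ (by positivity)
  -- The squared length of the gradient is `(N² - 4 ε x²) / N⁴`; then Cauchy-Schwarz.
  set a := N - 2 * ε * ζ.re ^ 2 with ha
  set b := -(2 * ε * ζ.re * ζ.im) with hb
  have hab : a ^ 2 + b ^ 2 = N ^ 2 - 4 * ε * ζ.re ^ 2 := by
    rw [ha, hb, hNdef]; ring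
  have hab' : a ^ 2 + b ^ 2 ≤ N ^ 4 := by
    have h1 : 0 ≤ 4 * ε * ζ.re ^ 2 := by positivity
    have h2 : N ^ 2 ≤ N ^ 4 := pow_le_pow_right₀ hN1 (by norm_num)
    linarith
  have hlin : k.re * N - ζ.re * (2 * ε * (ζ.re * k.re + ζ.im * k.im)) = a * k.re + b * k.im := by
    rw [ha, hb]; ring
  rw [hlin, mul_pow, hk]
  calc (a * k.re + b * k.im) ^ 2 ≤ (a ^ 2 + b ^ 2) * (k.re ^ 2 + k.im ^ 2) := by
        nlinarith [sq_nonneg (a * k.im - b * k.re)]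
    _ ≤ N ^ 4 * (k.re ^ 2 + k.im ^ 2) := by gcongr
    _ = _ := by ring

theorem sphericalRe_sq_of_fderiv_eq_zero (hε : 0 < ε) {ζ : ℂ}
    (h : fderiv ℝ (sphericalRe ε) ζ = 0) : 4 * ε * sphericalRe ε ζ ^ 2 = 1 := by
  have hN := sphericalRe_denom_pos hε ζ
  have h1 := fderiv_sphericalRe_apply hε ζ 1
  have hI := fderiv_sphericalRe_apply hε ζ Complex.I
  rw [h, zero_apply, eq_comm, div_eq_zero_iff,
    or_iff_left (pow_pos hN 2).ne'] at h1 hI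
  simp at h1 hI
  have him : ζ.im = 0 := by
    rcases hI with h0 | h0 | h0
    · rw [h0] at h1
      nlinarith [mul_nonneg hε.le (sq_nonneg ζ.im)]
    · exact absurd h0 hε.ne'
    · exact h0
  rw [him] at h1
  have hx : ε * ζ.re ^ 2 = 1 := by linarith
  rw [sphericalRe, him]
  have : 1 + ε * (ζ.re ^ 2 + 0 ^ 2) = 2 := by linarith
  rw [this]
  linarith

theorem abs_sphericalRe_le (hε : 0 < ε) (ζ : ℂ) : |sphericalRe ε ζ| ≤ 1 + 1 / ε := by
  have hN := sphericalRe_denom_pos hε ζ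
  rw [sphericalRe, abs_div, abs_of_pos hN, div_le_iff₀ hN]
  have h1 : (1 + 1 / ε) * (1 + ε * (ζ.re ^ 2 + ζ.im ^ 2)) =
      1 + 1 / ε + ε * (ζ.re ^ 2 + ζ.im ^ 2) + (ζ.re ^ 2 + ζ.im ^ 2) := by
    field_simp; ring
  have h2 : 0 ≤ 1 / ε + ε * (ζ.re ^ 2 + ζ.im ^ 2) := by positivity
  rw [h1]
  nlinarith [sq_abs ζ.re, sq_nonneg (|ζ.re| - 1), sq_nonneg ζ.im, abs_nonneg ζ.re]

theorem tendsto_sphericalRe_cobounded (hε : 0 < ε) :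
    Tendsto (sphericalRe ε) (Bornology.cobounded ℂ) (𝓝 0) := by
  have hlim : Tendsto (fun ζ : ℂ => ε⁻¹ * ‖ζ‖⁻¹) (Bornology.cobounded ℂ) (𝓝 0) := by
    simpa using (tendsto_inv_atTop_zero.comp tendsto_norm_cobounded_atTop).const_mul ε⁻¹
  refine squeeze_zero_norm (fun ζ => ?_) hlim
  have hN := sphericalRe_denom_pos hε ζ
  rcases eq_or_ne ζ 0 with rfl | hζ
  · simp [sphericalRe]
  have hζ' : 0 < ‖ζ‖ := norm_pos_iff.2 hζ
  have hk : ‖ζ‖ ^ 2 = ζ.re ^ 2 + ζ.im ^ 2 := by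
    rw [← Complex.normSq_eq_norm_sq, Complex.normSq_apply]; ring
  rw [Real.norm_eq_abs, sphericalRe, abs_div, abs_of_pos hN, div_le_iff₀ hN, ← hk]
  have h2 : ε⁻¹ * ‖ζ‖⁻¹ * (1 + ε * ‖ζ‖ ^ 2) = ε⁻¹ * ‖ζ‖⁻¹ + ‖ζ‖ := by
    field_simp
  have h3 : 0 ≤ ε⁻¹ * ‖ζ‖⁻¹ := by positivity
  rw [h2]
  linarith [Complex.abs_re_le_norm ζ]

end sphericalRe

theorem norm_fderiv_one_le_gradNorm (F : ℂ → ℂ) (z : ℂ) : ‖fderiv ℝ F z 1‖ ≤ gradNorm F z := by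
  rw [gradNorm]
  exact Real.le_sqrt_of_sq_le (le_add_of_nonneg_right (sq_nonneg _))

theorem gradNorm_const_mul (c : ℂ) (F : ℂ → ℂ) (z : ℂ) :
    gradNorm (fun z => c * F z) z = ‖c‖ * gradNorm F z := by
  have h : fderiv ℝ (fun z => c * F z) z = c • fderiv ℝ F z :=
    congrFun (fderiv_const_smul_field (𝕜 := ℝ) (f := F) c) z
  rw [gradNorm, gradNorm, h]
  simp only [smul_apply, smul_eq_mul, norm_mul, mul_pow]
  rw [← mul_add, Real.sqrt_mul (sq_nonneg _), Real.sqrt_sq (norm_nonneg _)]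

theorem fderiv_sphericalRe_comp_apply {ε : ℝ} (hε : 0 < ε) {f : ℂ → ℂ} {z : ℂ}
    (hf : AnalyticAt ℂ f z) (k : ℂ) :
    fderiv ℝ (fun z => sphericalRe ε (f z)) z k =
      fderiv ℝ (sphericalRe ε) (f z) (deriv f z * k) := by
  have hfd : HasFDerivAt f ((ContinuousLinearMap.toSpanSingleton ℂ (deriv f z)).restrictScalars ℝ) z :=
    hf.differentiableAt.hasDerivAt.hasFDerivAt.restrictScalars ℝ
  have hg := ((contDiff_sphericalRe hε).differentiable (by simp) (f z)).hasFDerivAt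
  have hgf : HasFDerivAt (fun z => sphericalRe ε (f z)) _ z := hg.comp z hfd
  rw [hgf.fderiv]
  simp [mul_comm]

/-- On a neighbourhood of a point at which `f` is analytic, the function `sphericalRe ε ∘ f` has
only countably many critical values: either `f` is locally constant, or the critical points of `f`
are isolated, and `sphericalRe ε` has only two critical values. -/
theorem exists_nhds_countable_critical_values {ε : ℝ} (hε : 0 < ε) {f : ℂ → ℂ} {z : ℂ}
    (hf : AnalyticAt ℂ f z) :
    ∃ N ∈ 𝓝 z, ((fun y => sphericalRe ε (f y)) ''
      (N ∩ {y | deriv f y = 0 ∨ fderiv ℝ (sphericalRe ε) (f y) = 0})).Countable := by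
  have hcrit : {x : ℝ | 4 * ε * x ^ 2 = 1}.Countable := by
    have : {x : ℝ | 4 * ε * x ^ 2 = 1} ⊆ {√(1 / (4 * ε)), -√(1 / (4 * ε))} := by
      intro x hx
      have hx : 4 * ε * x ^ 2 = 1 := hx
      refine sq_eq_sq_iff_eq_or_eq_neg.1 ?_
      rw [Real.sq_sqrt (by positivity)]
      field_simp
      linarith
    exact (Set.toFinite _).countable.mono this
  rcases hf.deriv.eventually_eq_zero_or_eventually_ne_zero with h0 | h0
  · obtain ⟨r, hr, hball⟩ := Metric.eventually_nhds_iff_ball.1 (h0.and hf.eventually_analyticAt)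
    refine ⟨Metric.ball z r, Metric.ball_mem_nhds z hr, ?_⟩
    refine (countable_singleton (sphericalRe ε (f z))).mono ?_
    rintro _ ⟨y, ⟨hy, -⟩, rfl⟩
    have hconst : f y = f z :=
      Metric.isOpen_ball.is_const_of_deriv_eq_zero (convex_ball z r).isPreconnected
        (fun x hx => (hball x hx).2.differentiableAt.differentiableWithinAt)
        (fun x hx => (hball x hx).1) hy (Metric.mem_ball_self hr)
    simp [hconst]
  · rw [eventually_nhdsWithin_iff] at h0
    refine ⟨_, h0, (hcrit.union (countable_singleton (sphericalRe ε (f z)))).mono ?_⟩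
    rintro _ ⟨y, ⟨hy, hy' | hy'⟩, rfl⟩
    · right
      by_cases hyz : y = z
      · simp [hyz]
      · exact absurd hy' (hy hyz)
    · exact Or.inl (sphericalRe_sq_of_fderiv_eq_zero hε hy')

/-- The compactified real part of a meromorphic function is regular off countably many levels. The
values of `F` at its poles are arbitrary; the normal form of `F` has the value `0` there, which
matches the limit `0` of `sphericalRe ε` at `∞`. -/
theorem exists_isRegularOff_sphericalRe {D : Set ℂ} (hD : IsOpen D) {F : ℂ → ℂ}
    (hF : MeromorphicOn F D) {ε : ℝ} (hε : 0 < ε) :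
    ∃ (v : ℂ → ℝ) (R : Set ℂ), IsRegularOff D R v ∧ (∀ z, |v z| ≤ 1 + 1 / ε) ∧
      ∀ᵐ z ∂volume.restrict D, v z = sphericalRe ε (F z) ∧
        (z ∈ R → ‖fderiv ℝ v z‖ₑ ≤ ‖gradNorm F z‖ₑ) := by
  set f := toMeromorphicNFOn F D with hf
  have hNF : MeromorphicNFOn f D := meromorphicNFOn_toMeromorphicNFOn F D
  set v : ℂ → ℝ := fun z => sphericalRe ε (f z) with hv
  have hg := contDiff_sphericalRe hε
  set R : Set ℂ := {z | z ∈ D ∧ AnalyticAt ℂ f z ∧ deriv f z ≠ 0 ∧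
    fderiv ℝ (sphericalRe ε) (f z) ≠ 0} with hR
  refine ⟨v, R, ⟨?_, fun z hz => hz.1, ?_, ?_, ?_, ?_⟩, fun z => abs_sphericalRe_le hε _, ?_⟩
  · intro z hz
    refine ContinuousAt.continuousWithinAt ?_
    rcases meromorphicNFAt_iff_analyticAt_or.1 (hNF hz) with h | ⟨-, hord, h0⟩
    · exact hg.continuous.continuousAt.comp h.continuousAt
    · rw [continuousAt_iff_punctured_nhds]
      have hvz : v z = 0 := by simp [hv, h0, sphericalRe]
      rw [hvz]
      exact (tendsto_sphericalRe_cobounded hε).comp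
        (tendsto_cobounded_of_meromorphicOrderAt_neg hord)
  · rw [isOpen_iff_mem_nhds]
    rintro z ⟨hzD, hza, hzd, hzg⟩
    have hgc : ContinuousAt (fun z => fderiv ℝ (sphericalRe ε) (f z)) z :=
      (hg.continuous_fderiv (by simp)).continuousAt.comp hza.continuousAt
    filter_upwards [hD.mem_nhds hzD, hza.eventually_analyticAt,
      hza.deriv.continuousAt.eventually_ne hzd, hgc.eventually_ne hzg] with y h1 h2 h3 h4
    exact ⟨h1, h2, h3, h4⟩
  · rintro z ⟨-, hza, -, -⟩
    have hfc : ContDiffAt ℝ ∞ f z := (hza.contDiffAt (n := ∞)).restrict_scalars ℝ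
    exact (hg.contDiffAt.comp z hfc).contDiffWithinAt
  · rintro z ⟨-, hza, hzd, hzg⟩ h0
    refine hzg (ContinuousLinearMap.ext fun k => ?_)
    have := fderiv_sphericalRe_comp_apply hε hza ((deriv f z)⁻¹ * k)
    rw [mul_inv_cancel_left₀ hzd] at this
    rw [← this, ← hv, h0]
    simp
  · have hloc : ∀ z ∈ D ∩ {z | AnalyticAt ℂ f z}, ∃ N ∈ 𝓝[D ∩ {z | AnalyticAt ℂ f z}] z,
        (v '' (N ∩ {y | deriv f y = 0 ∨ fderiv ℝ (sphericalRe ε) (f y) = 0})).Countable := by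
      rintro z ⟨-, hz⟩
      obtain ⟨N, hN, hc⟩ := exists_nhds_countable_critical_values hε hz
      exact ⟨N, mem_nhdsWithin_of_mem_nhds hN, hc⟩
    choose! N hN hNc using hloc
    obtain ⟨T, hTs, hTc, hT⟩ := TopologicalSpace.countable_cover_nhdsWithin hN
    refine ((hTc.biUnion fun z hz => hNc z (hTs hz)).union
      (hNF.meromorphicOn.countable_compl_analyticAt_inter.image v)).mono ?_
    rintro _ ⟨y, ⟨hyD, hyR⟩, rfl⟩
    by_cases hya : AnalyticAt ℂ f y
    · left
      obtain ⟨z, hzT, hyz⟩ := mem_iUnion₂.1 (hT ⟨hyD, hya⟩)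
      refine mem_iUnion₂.2 ⟨z, hzT, mem_image_of_mem v ⟨hyz, ?_⟩⟩
      by_contra hcon
      have hcon : ¬(deriv f y = 0 ∨ fderiv ℝ (sphericalRe ε) (f y) = 0) := hcon
      rw [not_or] at hcon
      exact hyR ⟨hyD, hya, hcon⟩
    · exact Or.inr (mem_image_of_mem v ⟨hya, hyD⟩)
  · have hS : ∀ᵐ z ∂volume.restrict D, z ∉ {z | AnalyticAt ℂ F z}ᶜ ∩ D :=
      ae_restrict_of_ae (measure_eq_zero_iff_ae_notMem.1
        (hF.countable_compl_analyticAt_inter.measure_zero volume))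
    filter_upwards [hS, ae_restrict_mem hD.measurableSet] with z hz hzD
    have hza : AnalyticAt ℂ F z := by
      by_contra h
      exact hz ⟨h, hzD⟩
    have hev : f =ᶠ[𝓝 z] F := by
      have := toMeromorphicNFOn_eq_toMeromorphicNFAt_on_nhds hF hzD
      rwa [toMeromorphicNFAt_eq_self.2 hza.meromorphicNFAt] at this
    refine ⟨by rw [hv]; simp only [hev.eq_of_nhds], fun hzR => ?_⟩
    have hle : ‖fderiv ℝ v z‖ ≤ gradNorm F z := by
      refine le_trans ?_ (norm_fderiv_one_le_gradNorm F z)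
      have h1 : fderiv ℝ F z 1 = deriv f z := by
        rw [hev.deriv_eq, (hza.differentiableAt.hasDerivAt.hasFDerivAt.restrictScalars ℝ).fderiv]
        simp
      rw [h1]
      refine ContinuousLinearMap.opNorm_le_bound _ (norm_nonneg _) fun k => ?_
      rw [hv, fderiv_sphericalRe_comp_apply hε hzR.2.1]
      refine (ContinuousLinearMap.le_of_opNorm_le _ (norm_fderiv_sphericalRe_le hε _) _).trans ?_
      rw [one_mul, norm_mul]
    rw [← ofReal_norm, ← ofReal_norm]
    exact ENNReal.ofReal_le_ofReal (hle.trans (le_abs_self _))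

/-! ### The weighted Poincaré inequality -/

theorem isFiniteMeasure_weightedMeasure {D : Set ℂ} {w : ℂ → ℝ} (hw : IntegrableOn w D volume) :
    IsFiniteMeasure (weightedMeasure D w) := by
  refine isFiniteMeasure_withDensity (ne_of_lt ?_)
  exact (lintegral_mono fun z => ENNReal.ofReal_le_ofReal (le_abs_self _)).trans_lt
    (by simpa only [HasFiniteIntegral, Real.enorm_eq_ofReal_abs] using hw.hasFiniteIntegral)

theorem weightedMean_eq_average {D : Set ℂ} (hD : IsOpen D) {w : ℂ → ℝ} (hw0 : ∀ z ∈ D, 0 ≤ w z)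
    (hw : IntegrableOn w D volume) (F : ℂ → ℂ) :
    weightedMean D w F = ⨍ z, F z ∂weightedMeasure D w := by
  have hnn : 0 ≤ᵐ[volume.restrict D] w := (ae_restrict_iff' hD.measurableSet).2
    (Eventually.of_forall hw0)
  have hmass : (weightedMeasure D w).real univ = ∫ z in D, w z := by
    rw [measureReal_def, weightedMeasure, withDensity_apply _ MeasurableSet.univ,
      Measure.restrict_univ, integral_eq_lintegral_of_nonneg_ae hnn hw.aestronglyMeasurable]
  have hint : ∫ z, F z ∂weightedMeasure D w = ∫ z in D, F z * (w z : ℂ) := by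
    rw [weightedMeasure, integral_withDensity_eq_integral_toReal_smul₀
      hw.aestronglyMeasurable.aemeasurable.ennreal_ofReal (by simp)]
    refine integral_congr_ae ?_
    filter_upwards [hnn] with z hz
    rw [ENNReal.toReal_ofReal hz, Complex.real_smul, mul_comm]
  rw [average_eq, hmass, hint, weightedMean, Complex.real_smul, one_div, Complex.ofReal_inv]

/-- Among all constants, the mean is a best `L^p` approximation up to a factor `2`. -/
theorem eLpNorm_sub_average_le {α : Type*} [MeasurableSpace α] {μ : Measure α} [IsFiniteMeasure μ]
    {f : α → ℂ} {p : ℝ≥0∞} (hp : 1 ≤ p) (hp' : p ≠ ⊤) (hf : Integrable f μ) (c : ℂ) :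
    eLpNorm (fun x => f x - ⨍ y, f y ∂μ) p μ ≤ 2 * eLpNorm (fun x => f x - c) p μ := by
  rcases eq_or_ne μ 0 with rfl | hμ
  · simp
  have : NeZero μ := ⟨hμ⟩
  have hfc : Integrable (fun x => f x - c) μ := hf.sub (integrable_const c)
  have hp0 : p ≠ 0 := (zero_lt_one.trans_le hp).ne'
  have hμ0 : μ univ ≠ 0 := by simpa using hμ
  set N := eLpNorm (fun x => f x - c) p μ with hN
  have havg : ⨍ y, (f y - c) ∂μ = ⨍ y, f y ∂μ - c := by
    rw [average_eq, average_eq, integral_sub hf (integrable_const c), integral_const, smul_sub,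
      smul_smul, inv_mul_cancel₀, one_smul]
    rw [measureReal_def, ENNReal.toReal_ne_zero]
    exact ⟨hμ0, measure_ne_top _ _⟩
  have hconst : eLpNorm (fun _ : α => ⨍ y, (f y - c) ∂μ) p μ ≤ N := by
    rw [eLpNorm_const' _ hp0 hp']
    have h1 : ‖⨍ y, (f y - c) ∂μ‖ₑ ≤ (μ univ)⁻¹ * (N * μ univ ^ (1 - 1 / p.toReal)) := by
      rw [average_eq, enorm_smul]
      have h2 : ‖(μ.real univ)⁻¹‖ₑ = (μ univ)⁻¹ := by
        rw [enorm_inv (by rw [measureReal_def, ENNReal.toReal_ne_zero]; exact ⟨hμ0, measure_ne_top _ _⟩),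
          measureReal_def, Real.enorm_of_nonneg ENNReal.toReal_nonneg,
          ENNReal.ofReal_toReal (measure_ne_top _ _)]
      rw [h2]
      refine mul_le_mul' le_rfl ((enorm_integral_le_lintegral_enorm _).trans ?_)
      rw [← eLpNorm_one_eq_lintegral_enorm]
      simpa using eLpNorm_le_eLpNorm_mul_rpow_measure_univ hp hfc.aestronglyMeasurable
    calc ‖⨍ y, (f y - c) ∂μ‖ₑ * μ univ ^ (1 / p.toReal)
        ≤ (μ univ)⁻¹ * (N * μ univ ^ (1 - 1 / p.toReal)) * μ univ ^ (1 / p.toReal) := by gcongr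
      _ = N * ((μ univ)⁻¹ * (μ univ ^ (1 - 1 / p.toReal) * μ univ ^ (1 / p.toReal))) := by ring
      _ = N := by
        rw [← ENNReal.rpow_add _ _ hμ0 (measure_ne_top _ _), sub_add_cancel, ENNReal.rpow_one,
          ENNReal.inv_mul_cancel hμ0 (measure_ne_top _ _), mul_one]
  have hdecomp : (fun x => f x - ⨍ y, f y ∂μ) =
      (fun x => f x - c) - fun _ => ⨍ y, (f y - c) ∂μ := by
    ext x
    simp only [Pi.sub_apply, havg]
    ring
  rw [hdecomp]
  refine (eLpNorm_sub_le hfc.aestronglyMeasurable aestronglyMeasurable_const hp).trans ?_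
  rw [two_mul]
  exact add_le_add le_rfl hconst

theorem sphericalRe_add_sphericalRe_mul_I {ε : ℝ} (ζ : ℂ) :
    ((sphericalRe ε ζ : ℝ) : ℂ) + ((sphericalRe ε (-Complex.I * ζ) : ℝ) : ℂ) * Complex.I =
      ζ / ((1 + ε * ‖ζ‖ ^ 2 : ℝ) : ℂ) := by
  have hk : ‖ζ‖ ^ 2 = ζ.re ^ 2 + ζ.im ^ 2 := by
    rw [← Complex.normSq_eq_norm_sq, Complex.normSq_apply]; ring
  have h1 : sphericalRe ε (-Complex.I * ζ) = ζ.im / (1 + ε * ‖ζ‖ ^ 2) := by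
    simp [sphericalRe, hk, add_comm]
  have h2 : sphericalRe ε ζ = ζ.re / (1 + ε * ‖ζ‖ ^ 2) := by rw [sphericalRe, hk]
  rw [h1, h2]
  rw [Complex.ofReal_div, Complex.ofReal_div, div_mul_eq_mul_div, ← add_div, Complex.re_add_im]

/-- The Poincaré inequality for the bounded approximation `F / (1 + ε |F|²)` of `F`. The factor
`4` is made up of a factor `2` for the real and the imaginary part, and a factor `2` for the passage
from medians to the mean. -/
theorem cheegerConstant_mul_eLpNorm_div_sub_average_le {D : Set ℂ} (hD : IsOpen D) {w : ℂ → ℝ}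
    (hw : IntegrableOn w D volume) {p : ℝ} (hp : 1 ≤ p) {F : ℂ → ℂ} (hF : MeromorphicOn F D)
    (hG : AEStronglyMeasurable (gradNorm F) (weightedMeasure D w)) {ε : ℝ} (hε : 0 < ε)
    {G : ℂ → ℂ} (hGdef : G = fun z => F z / ((1 + ε * ‖F z‖ ^ 2 : ℝ) : ℂ))
    (hGm : Integrable G (weightedMeasure D w)) :
    cheegerConstant D w * eLpNorm (fun z => G z - ⨍ y, G y ∂weightedMeasure D w)
        (ENNReal.ofReal p) (weightedMeasure D w) ≤
      ENNReal.ofReal (4 * p) * eLpNorm (gradNorm F) (ENNReal.ofReal p) (weightedMeasure D w) := by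
  have := isFiniteMeasure_weightedMeasure hw
  set μ := weightedMeasure D w with hμ
  have hac : μ ≪ volume.restrict D := withDensity_absolutelyContinuous _ _
  have hwm : AEMeasurable w (volume.restrict D) := hw.aestronglyMeasurable.aemeasurable
  have hp' : 1 ≤ ENNReal.ofReal p := by simpa using hp
  obtain ⟨v₁, R₁, hR₁, hb₁, hv₁⟩ := exists_isRegularOff_sphericalRe hD hF hε
  have hFI : MeromorphicOn (fun z => -Complex.I * F z) D :=
    (MeromorphicOn.const (-Complex.I)).mul hF
  obtain ⟨v₂, R₂, hR₂, hb₂, hv₂⟩ := exists_isRegularOff_sphericalRe hD hFI hε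
  replace hv₁ : ∀ᵐ z ∂μ, _ := hac.ae_le hv₁
  replace hv₂ : ∀ᵐ z ∂μ, _ := hac.ae_le hv₂
  obtain ⟨m₁, hm₁⟩ := hR₁.exists_cheegerConstant_mul_eLpNorm_sub_le hD hwm hp
    (fun z _ => hb₁ z) hG (hv₁.mono fun z hz => hz.2)
  obtain ⟨m₂, hm₂⟩ := hR₂.exists_cheegerConstant_mul_eLpNorm_sub_le hD hwm hp
    (fun z _ => hb₂ z) hG (hv₂.mono fun z hz => by
      simpa only [gradNorm_const_mul, norm_neg, Complex.norm_I, one_mul] using hz.2)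
  set c : ℂ := m₁ + m₂ * Complex.I with hc
  have hbound : eLpNorm (fun z => G z - c) (ENNReal.ofReal p) μ ≤
      eLpNorm (fun z => v₁ z - m₁) (ENNReal.ofReal p) μ +
        eLpNorm (fun z => v₂ z - m₂) (ENNReal.ofReal p) μ := by
    have hm1 : AEStronglyMeasurable (fun z => v₁ z - m₁) μ :=
      ((hR₁.aemeasurable hD w).sub_const m₁).aestronglyMeasurable
    have hm2 : AEStronglyMeasurable (fun z => v₂ z - m₂) μ :=
      ((hR₂.aemeasurable hD w).sub_const m₂).aestronglyMeasurable
    have hle : eLpNorm (fun z => G z - c) (ENNReal.ofReal p) μ ≤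
        eLpNorm ((fun z => ‖v₁ z - m₁‖) + fun z => ‖v₂ z - m₂‖) (ENNReal.ofReal p) μ := by
      refine eLpNorm_mono_ae ?_
      filter_upwards [hv₁, hv₂] with z h1 h2
      have hGz : G z - c = ((v₁ z - m₁ : ℝ) : ℂ) + ((v₂ z - m₂ : ℝ) : ℂ) * Complex.I := by
        rw [hGdef, h1.1, h2.1, hc]
        simp only
        rw [← sphericalRe_add_sphericalRe_mul_I]
        push_cast
        ring
      rw [hGz]
      refine (norm_add_le _ _).trans ?_
      rw [norm_mul, Complex.norm_I, mul_one, Complex.norm_real, Complex.norm_real]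
      exact le_abs_self _
    refine hle.trans ((eLpNorm_add_le hm1.norm hm2.norm hp').trans ?_)
    rw [eLpNorm_norm, eLpNorm_norm]
  calc cheegerConstant D w * eLpNorm (fun z => G z - ⨍ y, G y ∂μ) (ENNReal.ofReal p) μ
      ≤ cheegerConstant D w * (2 * (eLpNorm (fun z => v₁ z - m₁) (ENNReal.ofReal p) μ +
          eLpNorm (fun z => v₂ z - m₂) (ENNReal.ofReal p) μ)) := by
        refine mul_le_mul' le_rfl ?_
        exact (eLpNorm_sub_average_le hp' ENNReal.ofReal_ne_top hGm c).trans
          (mul_le_mul' le_rfl hbound)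
    _ = 2 * (cheegerConstant D w * eLpNorm (fun z => v₁ z - m₁) (ENNReal.ofReal p) μ +
          cheegerConstant D w * eLpNorm (fun z => v₂ z - m₂) (ENNReal.ofReal p) μ) := by ring
    _ ≤ 2 * (ENNReal.ofReal p * eLpNorm (gradNorm F) (ENNReal.ofReal p) μ +
          ENNReal.ofReal p * eLpNorm (gradNorm F) (ENNReal.ofReal p) μ) :=
        mul_le_mul' le_rfl (add_le_add hm₁ hm₂)
    _ = _ := by
        rw [ENNReal.ofReal_mul (by norm_num), ENNReal.ofReal_ofNat]
        ring

/-- The Poincaré inequality for `F` follows from the one for `F / (1 + ε |F|²)` by Fatou's lemma, as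
`ε → 0`; the means converge by dominated convergence. -/
theorem eLpNorm_sub_weightedMean_le {D : Set ℂ} (hD : IsOpen D) {w : ℂ → ℝ}
    (hw0 : ∀ z ∈ D, 0 ≤ w z) (hw : IntegrableOn w D volume) (hh : 0 < cheegerConstant D w)
    {p : ℝ} (hp : 1 ≤ p) {F : ℂ → ℂ} (hF : IsMeromorphicSobolev p D w F) :
    weightedNorm p D w (fun z => F z - weightedMean D w F) ≤
      ENNReal.ofReal (4 * p) / cheegerConstant D w * weightedNorm p D w (gradNorm F) := by
  have := isFiniteMeasure_weightedMeasure hw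
  rw [weightedMean_eq_average hD hw0 hw]
  unfold weightedNorm
  set μ := weightedMeasure D w with hμ
  have hp' : 1 ≤ ENNReal.ofReal p := by simpa using hp
  have hF1 : Integrable F μ := memLp_one_iff_integrable.1 (hF.memLp.mono_exponent hp')
  set ε : ℕ → ℝ := fun n => 1 / ((n : ℝ) + 1) with hε
  have hεpos : ∀ n, 0 < ε n := fun n => by positivity
  have hεlim : Tendsto ε atTop (𝓝 0) := tendsto_one_div_add_atTop_nhds_zero_nat
  set G : ℕ → ℂ → ℂ := fun n z => F z / ((1 + ε n * ‖F z‖ ^ 2 : ℝ) : ℂ) with hG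
  have hone : ∀ n z, 1 ≤ 1 + ε n * ‖F z‖ ^ 2 := fun n z => by
    have : 0 ≤ ε n * ‖F z‖ ^ 2 := mul_nonneg (hεpos n).le (sq_nonneg _)
    linarith
  have hGle : ∀ n z, ‖G n z‖ ≤ ‖F z‖ := by
    intro n z
    rw [hG]
    simp only
    rw [norm_div, Complex.norm_real, Real.norm_of_nonneg (zero_le_one.trans (hone n z))]
    exact div_le_self (norm_nonneg _) (hone n z)
  have hFm : AEMeasurable F μ := hF1.aestronglyMeasurable.aemeasurable
  have hGm : ∀ n, AEStronglyMeasurable (G n) μ := fun n =>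
    (hFm.div (Complex.measurable_ofReal.comp_aemeasurable
      (((hFm.norm.pow_const 2).const_mul (ε n)).const_add 1))).aestronglyMeasurable
  have hGi : ∀ n, Integrable (G n) μ := fun n =>
    hF1.mono (hGm n) (Eventually.of_forall (hGle n))
  have hGlim : ∀ z, Tendsto (fun n => G n z) atTop (𝓝 (F z)) := by
    intro z
    have h1 : Tendsto (fun n => ((1 + ε n * ‖F z‖ ^ 2 : ℝ) : ℂ)) atTop (𝓝 ((1 : ℝ) : ℂ)) := by
      refine (Complex.continuous_ofReal.tendsto 1).comp ?_
      simpa using (hεlim.mul_const (‖F z‖ ^ 2)).const_add 1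
    have h2 := (tendsto_const_nhds (x := F z)).div h1 (by simp)
    rw [Complex.ofReal_one, div_one] at h2
    exact h2
  have hmean : Tendsto (fun n => ⨍ z, G n z ∂μ) atTop (𝓝 (⨍ z, F z ∂μ)) := by
    simp_rw [average_eq]
    exact (tendsto_integral_of_dominated_convergence (fun z => ‖F z‖) hGm hF1.norm
      (fun n => Eventually.of_forall (hGle n)) (Eventually.of_forall hGlim)).const_smul _
  have hYtop : eLpNorm (gradNorm F) (ENNReal.ofReal p) μ ≠ ⊤ := hF.grad_memLp.eLpNorm_ne_top
  have hn : ∀ n, eLpNorm (fun z => G n z - ⨍ y, G n y ∂μ) (ENNReal.ofReal p) μ ≤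
      ENNReal.ofReal (4 * p) / cheegerConstant D w *
        eLpNorm (gradNorm F) (ENNReal.ofReal p) μ := by
    intro n
    have h := cheegerConstant_mul_eLpNorm_div_sub_average_le hD hw hp hF.meromorphicOn
      hF.grad_memLp.aestronglyMeasurable (hεpos n) (G := G n) rfl
      (hGi n)
    rw [mul_comm (_ / _), ← mul_div_assoc, mul_comm _ (ENNReal.ofReal _),
      ENNReal.le_div_iff_mul_le (Or.inl hh.ne')
        (Or.inr (ENNReal.mul_ne_top ENNReal.ofReal_ne_top hYtop)), mul_comm]
    exact h
  refine (Lp.eLpNorm_lim_le_liminf_eLpNorm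
    (f := fun n z => G n z - ⨍ y, G n y ∂μ) (fun n => (hGm n).sub aestronglyMeasurable_const) _
    (Eventually.of_forall fun z => (hGlim z).sub hmean)).trans ?_
  refine liminf_le_of_le (by isBoundedDefault) fun b hb => ?_
  obtain ⟨n, hbn⟩ := hb.exists
  exact hbn.trans (hn n)

theorem poincareConstant_le {D : Set ℂ} (hD : IsOpen D) {w : ℂ → ℝ}
    (hw0 : ∀ z ∈ D, 0 ≤ w z) (hw : IntegrableOn w D volume) (hh : 0 < cheegerConstant D w)
    {p : ℝ} (hp : 1 ≤ p) :
    poincareConstant p D w ≤ ENNReal.ofReal (4 * p) / cheegerConstant D w := by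
  have hfin : ENNReal.ofReal (4 * p) / cheegerConstant D w ≠ ⊤ :=
    ENNReal.div_ne_top ENNReal.ofReal_ne_top hh.ne'
  refine (iInf₂_le (ENNReal.ofReal (4 * p) / cheegerConstant D w).toNNReal fun F hF => ?_).trans
    (ENNReal.coe_toNNReal hfin).le
  rw [ENNReal.coe_toNNReal hfin]
  exact eLpNorm_sub_weightedMean_le hD hw0 hw hh hp hF

/-! ### Continuity of the Gabor transform -/

/-- A family of functions on the line all of whose polynomially weighted sup norms are finite and
depend continuously on the parameter. -/
def IsRapidlyContinuous (u : ℝ × ℝ → ℝ → ℂ) : Prop :=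
  ∀ (k : ℕ) (s₀ : ℝ × ℝ), (∃ C, ∀ t, |t| ^ k * ‖u s₀ t‖ ≤ C) ∧
    ∀ ε > 0, ∀ᶠ s in 𝓝 s₀, ∀ t, |t| ^ k * ‖u s t - u s₀ t‖ ≤ ε

theorem IsRapidlyContinuous.add {u v : ℝ × ℝ → ℝ → ℂ} (hu : IsRapidlyContinuous u)
    (hv : IsRapidlyContinuous v) : IsRapidlyContinuous fun s t => u s t + v s t := by
  intro k s₀
  obtain ⟨⟨A, hA⟩, hu⟩ := hu k s₀
  obtain ⟨⟨B, hB⟩, hv⟩ := hv k s₀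
  refine ⟨⟨A + B, fun t => ?_⟩, fun ε hε => ?_⟩
  · calc |t| ^ k * ‖u s₀ t + v s₀ t‖ ≤ |t| ^ k * (‖u s₀ t‖ + ‖v s₀ t‖) := by
          gcongr; exact norm_add_le _ _
      _ ≤ A + B := by rw [mul_add]; exact add_le_add (hA t) (hB t)
  · filter_upwards [hu (ε / 2) (half_pos hε), hv (ε / 2) (half_pos hε)] with s h1 h2 t
    calc |t| ^ k * ‖u s t + v s t - (u s₀ t + v s₀ t)‖
        ≤ |t| ^ k * (‖u s t - u s₀ t‖ + ‖v s t - v s₀ t‖) := by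
          gcongr
          rw [add_sub_add_comm]
          exact norm_add_le _ _
      _ ≤ ε := by rw [mul_add]; linarith [h1 t, h2 t]

theorem IsRapidlyContinuous.id_mul {u : ℝ × ℝ → ℝ → ℂ} (hu : IsRapidlyContinuous u) :
    IsRapidlyContinuous fun s t => (t : ℂ) * u s t := by
  intro k s₀
  obtain ⟨⟨A, hA⟩, hu⟩ := hu (k + 1) s₀
  have key : ∀ (t : ℝ) (z : ℂ), |t| ^ k * ‖(t : ℂ) * z‖ = |t| ^ (k + 1) * ‖z‖ := fun t z => by
    rw [norm_mul, Complex.norm_real, Real.norm_eq_abs, pow_succ, mul_assoc]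
  refine ⟨⟨A, fun t => (key t _).trans_le (hA t)⟩, fun ε hε => ?_⟩
  filter_upwards [hu ε hε] with s h t
  rw [← mul_sub, key]
  exact h t

theorem IsRapidlyContinuous.smul {u : ℝ × ℝ → ℝ → ℂ} (hu : IsRapidlyContinuous u)
    {c : ℝ × ℝ → ℂ} (hc : Continuous c) : IsRapidlyContinuous fun s t => c s * u s t := by
  intro k s₀
  obtain ⟨⟨A, hA⟩, hu⟩ := hu k s₀
  have hA0 : 0 ≤ A := (mul_nonneg (pow_nonneg (abs_nonneg 0) k) (norm_nonneg _)).trans (hA 0)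
  refine ⟨⟨‖c s₀‖ * A, fun t => ?_⟩, fun ε hε => ?_⟩
  · calc |t| ^ k * ‖c s₀ * u s₀ t‖ = ‖c s₀‖ * (|t| ^ k * ‖u s₀ t‖) := by rw [norm_mul]; ring
      _ ≤ ‖c s₀‖ * A := by gcongr; exact hA t
  · have h1 : ∀ᶠ s in 𝓝 s₀, ‖c s‖ < ‖c s₀‖ + 1 :=
      hc.norm.continuousAt.eventually (gt_mem_nhds (lt_add_one _))
    have h2 : ∀ᶠ s in 𝓝 s₀, ‖c s - c s₀‖ < ε / (2 * (A + 1)) := by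
      have : Tendsto (fun s => ‖c s - c s₀‖) (𝓝 s₀) (𝓝 0) := by
        simpa using (hc.sub (continuous_const (y := c s₀))).norm.tendsto s₀
      exact this.eventually (gt_mem_nhds (by positivity))
    filter_upwards [h1, h2, hu (ε / (2 * (‖c s₀‖ + 1))) (by positivity)] with s h1 h2 h3 t
    have e1 : ‖c s‖ * (|t| ^ k * ‖u s t - u s₀ t‖) ≤ ε / 2 := by
      calc ‖c s‖ * (|t| ^ k * ‖u s t - u s₀ t‖)
          ≤ (‖c s₀‖ + 1) * (ε / (2 * (‖c s₀‖ + 1))) := by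
            gcongr
            exact h3 t
        _ = ε / 2 := by field_simp
    have e2 : ‖c s - c s₀‖ * (|t| ^ k * ‖u s₀ t‖) ≤ ε / 2 := by
      calc ‖c s - c s₀‖ * (|t| ^ k * ‖u s₀ t‖) ≤ ε / (2 * (A + 1)) * (A + 1) := by
            gcongr
            exact (hA t).trans (le_add_of_nonneg_right zero_le_one)
        _ = ε / 2 := by field_simp
    calc |t| ^ k * ‖c s * u s t - c s₀ * u s₀ t‖
        ≤ |t| ^ k * (‖c s * (u s t - u s₀ t)‖ + ‖(c s - c s₀) * u s₀ t‖) := by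
          gcongr
          rw [show c s * u s t - c s₀ * u s₀ t =
            c s * (u s t - u s₀ t) + (c s - c s₀) * u s₀ t by ring]
          exact norm_add_le _ _
      _ = ‖c s‖ * (|t| ^ k * ‖u s t - u s₀ t‖) + ‖c s - c s₀‖ * (|t| ^ k * ‖u s₀ t‖) := by
          rw [norm_mul, norm_mul]; ring
      _ ≤ ε := by linarith

theorem isRapidlyContinuous_gaborAtomFun :
    IsRapidlyContinuous fun s => gaborAtomFun s.1 s.2 := by
  rintro k ⟨x₀, y₀⟩
  refine ⟨gaborAtomFun_pow_bound x₀ y₀ k, fun ε hε => ?_⟩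
  set η : ℝ × ℝ → ℝ := fun s =>
    Real.pi * |s.1 ^ 2 - x₀ ^ 2| + 2 * Real.pi * |s.1 - x₀| + 2 * Real.pi * |s.2 - y₀| with hη
  have hη0 : ∀ s, 0 ≤ η s := fun s => by
    have := Real.pi_pos
    positivity
  have hηlim : Tendsto η (𝓝 (x₀, y₀)) (𝓝 0) := by
    have hcont : Continuous η := by fun_prop
    simpa [hη] using hcont.tendsto (x₀, y₀)
  set K : ℝ := (k + 1).factorial * Real.exp (3 + 2 * |x₀|) with hK
  have hKpos : 0 < K := by positivity
  filter_upwards [hηlim.eventually (gt_mem_nhds zero_lt_one),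
    hηlim.eventually (gt_mem_nhds (div_pos hε hKpos))] with s hs1 hs2 t
  set d : ℂ := ((-Real.pi * (s.1 ^ 2 - x₀ ^ 2) + 2 * Real.pi * (s.1 - x₀) * t : ℝ) : ℂ) +
    ((-(2 * Real.pi * (s.2 - y₀) * t) : ℝ) : ℂ) * Complex.I with hd
  have hatom : gaborAtomFun s.1 s.2 t = gaborAtomFun x₀ y₀ t * Complex.exp d := by
    rw [gaborAtomFun, gaborAtomFun, ← Complex.exp_add, ← Complex.exp_add, ← Complex.exp_add, hd]
    congr 1
    push_cast
    ring
  have hdle : ‖d‖ ≤ η s * (1 + |t|) := by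
    have hpi := Real.pi_pos
    have h1 : ‖d‖ ≤ |-Real.pi * (s.1 ^ 2 - x₀ ^ 2) + 2 * Real.pi * (s.1 - x₀) * t| +
        |2 * Real.pi * (s.2 - y₀) * t| := by
      refine (norm_add_le _ _).trans ?_
      rw [norm_mul, Complex.norm_I, mul_one, Complex.norm_real, Complex.norm_real,
        Real.norm_eq_abs, Real.norm_eq_abs, abs_neg]
    have h2 : |-Real.pi * (s.1 ^ 2 - x₀ ^ 2) + 2 * Real.pi * (s.1 - x₀) * t| ≤
        Real.pi * |s.1 ^ 2 - x₀ ^ 2| + 2 * Real.pi * |s.1 - x₀| * |t| := by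
      refine (abs_add_le _ _).trans (le_of_eq ?_)
      simp [abs_mul, abs_of_pos hpi]
    have h3 : |2 * Real.pi * (s.2 - y₀) * t| = 2 * Real.pi * |s.2 - y₀| * |t| := by
      simp [abs_mul, abs_of_pos hpi]
    have h4 : 0 ≤ Real.pi * |s.1 ^ 2 - x₀ ^ 2| * |t| := by positivity
    have h5 : 0 ≤ 2 * Real.pi * |s.1 - x₀| := by positivity
    have h6 : 0 ≤ 2 * Real.pi * |s.2 - y₀| := by positivity
    simp only [hη]
    linarith
  have hexp : ‖Complex.exp d - 1‖ ≤ η s * (1 + |t|) * Real.exp (1 + |t|) := by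
    have h1 := Complex.norm_exp_sub_sum_le_norm_mul_exp d 1
    simp only [Finset.range_one, Finset.sum_singleton, pow_zero, Nat.factorial_zero, Nat.cast_one,
      div_one, pow_one] at h1
    refine h1.trans ?_
    have h2 : ‖d‖ ≤ 1 + |t| := hdle.trans (mul_le_of_le_one_left (by positivity) hs1.le)
    gcongr
  have hpoly : |t| ^ k * (1 + |t|) ≤ (k + 1).factorial * Real.exp (1 + |t|) := by
    have h1 := Real.pow_div_factorial_le_exp (1 + |t|) (by positivity) (k + 1)
    rw [div_le_iff₀ (by positivity)] at h1
    calc |t| ^ k * (1 + |t|) ≤ (1 + |t|) ^ k * (1 + |t|) := by gcongr; linarith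
      _ = (1 + |t|) ^ (k + 1) := (pow_succ _ _).symm
      _ ≤ _ := by linarith
  have hquad : -Real.pi * (t - x₀) ^ 2 + (1 + |t|) + (1 + |t|) ≤ 3 + 2 * |x₀| := by
    have hpi := Real.pi_gt_three
    have h1 : |t| ≤ |t - x₀| + |x₀| := by
      simpa using abs_add_le (t - x₀) x₀
    nlinarith [sq_abs (t - x₀), sq_nonneg (|t - x₀| - 1), sq_nonneg (t - x₀)]
  calc |t| ^ k * ‖gaborAtomFun s.1 s.2 t - gaborAtomFun x₀ y₀ t‖
      = |t| ^ k * (Real.exp (-Real.pi * (t - x₀) ^ 2) * ‖Complex.exp d - 1‖) := by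
        rw [hatom, ← gaborAtomFun_norm x₀ y₀ t, ← norm_mul]
        congr 2
        ring
    _ ≤ |t| ^ k * (Real.exp (-Real.pi * (t - x₀) ^ 2) *
          (η s * (1 + |t|) * Real.exp (1 + |t|))) := by gcongr
    _ = η s * (|t| ^ k * (1 + |t|)) *
          (Real.exp (-Real.pi * (t - x₀) ^ 2) * Real.exp (1 + |t|)) := by ring
    _ ≤ η s * ((k + 1).factorial * Real.exp (1 + |t|)) *
          (Real.exp (-Real.pi * (t - x₀) ^ 2) * Real.exp (1 + |t|)) := by
        have := hη0 s
        gcongr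
    _ = η s * ((k + 1).factorial *
          Real.exp (-Real.pi * (t - x₀) ^ 2 + (1 + |t|) + (1 + |t|))) := by
        rw [Real.exp_add (_ + _) (1 + |t|), Real.exp_add (-Real.pi * _) (1 + |t|)]; ring
    _ ≤ η s * K := by
        have := hη0 s
        rw [hK]
        gcongr
    _ ≤ ε := by
        rw [lt_div_iff₀ hKpos] at hs2
        exact hs2.le

/-- The three-term recursion for the derivatives of a Gaussian. -/
theorem iteratedDeriv_add_two_gaborAtomFun (x y : ℝ) (n : ℕ) (t : ℝ) :
    iteratedDeriv (n + 2) (gaborAtomFun x y) t =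
      (-2 * Real.pi * ((t : ℂ) - x) - 2 * Real.pi * Complex.I * y) *
          iteratedDeriv (n + 1) (gaborAtomFun x y) t +
        (-2 * Real.pi * (n + 1)) * iteratedDeriv n (gaborAtomFun x y) t := by
  have hdiff : ∀ (m : ℕ) (t : ℝ), HasDerivAt (iteratedDeriv m (gaborAtomFun x y))
      (iteratedDeriv (m + 1) (gaborAtomFun x y) t) t := by
    intro m t
    rw [iteratedDeriv_succ]
    exact ((gaborAtomFun_contDiff x y).differentiable_iteratedDeriv m
      (by exact_mod_cast WithTop.coe_lt_top m) t).hasDerivAt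
  have hlin : ∀ t : ℝ, HasDerivAt
      (fun t : ℝ => (-2 * Real.pi * ((t : ℂ) - x) - 2 * Real.pi * Complex.I * y))
      (-2 * Real.pi : ℂ) t := by
    intro t
    have hid : HasDerivAt (fun t : ℝ => (t : ℂ)) 1 t := Complex.ofRealCLM.hasDerivAt
    simpa using ((hid.sub_const (x : ℂ)).const_mul (-2 * Real.pi : ℂ)).sub_const
      (2 * Real.pi * Complex.I * y)
  have h1 : iteratedDeriv 1 (gaborAtomFun x y) = fun t : ℝ =>
      (-2 * Real.pi * ((t : ℂ) - x) - 2 * Real.pi * Complex.I * y) * gaborAtomFun x y t := by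
    rw [iteratedDeriv_one]
    exact funext fun t => (gaborAtomFun_hasDerivAt x y t).deriv
  induction n generalizing t with
  | zero =>
    have h : HasDerivAt (iteratedDeriv 1 (gaborAtomFun x y)) _ t :=
      ((hlin t).mul (hdiff 0 t)).congr_of_eventuallyEq (Eventually.of_forall fun t => by
        rw [h1, iteratedDeriv_zero]; rfl)
    refine ((hdiff 1 t).unique h).trans ?_
    simp
    ring
  | succ n ih =>
    have h : HasDerivAt (iteratedDeriv (n + 2) (gaborAtomFun x y)) _ t :=
      (((hlin t).mul (hdiff (n + 1) t)).add
        ((hdiff n t).const_mul (-2 * Real.pi * (n + 1) : ℂ))).congr_of_eventuallyEq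
        (Eventually.of_forall fun t => by rw [ih]; rfl)
    refine ((hdiff (n + 2) t).unique h).trans ?_
    push_cast
    ring

theorem isRapidlyContinuous_iteratedDeriv_gaborAtomFun (n : ℕ) :
    IsRapidlyContinuous fun s => iteratedDeriv n (gaborAtomFun s.1 s.2) := by
  have hc : Continuous fun s : ℝ × ℝ =>
      (2 * Real.pi * (s.1 : ℂ) - 2 * Real.pi * Complex.I * (s.2 : ℂ)) := by fun_prop
  have hstep : ∀ {u : ℝ × ℝ → ℝ → ℂ}, IsRapidlyContinuous u → IsRapidlyContinuous fun s t =>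
      (-2 * Real.pi * ((t : ℂ) - s.1) - 2 * Real.pi * Complex.I * s.2) * u s t := by
    intro u hu
    have h := (hu.id_mul.smul (c := fun _ => (-2 * Real.pi : ℂ)) continuous_const).add (hu.smul hc)
    convert h using 3
    ring
  induction n using Nat.twoStepInduction with
  | zero => simpa only [iteratedDeriv_zero] using isRapidlyContinuous_gaborAtomFun
  | one =>
    convert hstep isRapidlyContinuous_gaborAtomFun using 3 with s t
    rw [iteratedDeriv_one]
    exact (gaborAtomFun_hasDerivAt _ _ _).deriv
  | more n h0 h1 =>
    have h := (hstep h1).add (h0.smul (c := fun _ => (-2 * Real.pi * (n + 1) : ℂ)) continuous_const)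
    convert h using 3
    exact iteratedDeriv_add_two_gaborAtomFun _ _ _ _

/-- The time-frequency shifts of the Gaussian depend continuously on the shift, in the topology of
the Schwartz space. -/
theorem continuous_gaborAtom : Continuous fun s : ℝ × ℝ => gaborAtom s.1 s.2 := by
  rw [continuous_iff_continuousAt]
  intro s₀
  refine ((schwartz_withSeminorms ℝ ℝ ℂ).tendsto_nhds _ _).2 ?_
  rintro ⟨k, n⟩ ε hε
  filter_upwards [(isRapidlyContinuous_iteratedDeriv_gaborAtomFun n k s₀).2 (ε / 2) (half_pos hε)]
    with s hs
  refine lt_of_le_of_lt (SchwartzMap.seminorm_le_bound' ℝ k n _ (half_pos hε).le fun t => ?_)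
    (half_lt_self hε)
  have hsub : iteratedDeriv n (⇑(gaborAtom s.1 s.2 - gaborAtom s₀.1 s₀.2)) t =
      iteratedDeriv n (gaborAtomFun s.1 s.2) t - iteratedDeriv n (gaborAtomFun s₀.1 s₀.2) t :=
    iteratedDeriv_sub (((gaborAtomFun_contDiff s.1 s.2).of_le (by exact_mod_cast le_top)).contDiffAt)
      (((gaborAtomFun_contDiff s₀.1 s₀.2).of_le (by exact_mod_cast le_top)).contDiffAt)
  rw [hsub]
  exact hs t

theorem continuous_gaborWeight {p : ℝ} (hp : 0 ≤ p) (f : 𝓢'(ℝ, ℂ)) :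
    Continuous (gaborWeight p f) := by
  have hpair : Continuous fun z : ℂ => (z.re, z.im) :=
    Complex.continuous_re.prodMk Complex.continuous_im
  have hatom : Continuous fun z : ℂ => gaborAtom z.re z.im := by
    exact Continuous.comp (g := fun s : ℝ × ℝ => gaborAtom s.1 s.2)
      (f := fun z : ℂ => (z.re, z.im)) continuous_gaborAtom hpair
  have hf : Continuous f := map_continuous f
  have h : Continuous fun z : ℂ => gaborTransform f z.re z.im := hf.comp hatom
  exact h.norm.rpow_const fun _ => Or.inr hp

/-! ### Integrability of the Gabor weight -/

/-- If `D` has infinite mass, then `D` itself is a competitor for the Cheeger constant: it has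
empty relative boundary, and its mass is at most half of the (infinite) total mass. -/
theorem weightedMeasure_ne_top_of_cheegerConstant_pos {D : Set ℂ} (hD : IsOpen D) {w : ℂ → ℝ}
    (h : 0 < cheegerConstant D w) : weightedMeasure D w D ≠ ⊤ := by
  intro htop
  have hfr : frontier D ∩ D = ∅ := by
    rw [hD.frontier_eq, sdiff_inter_self]
  have hcomp : IsCheegerCompetitor D w D := by
    refine ⟨Subset.rfl, hD, ?_, by simp [htop], ?_⟩
    · rw [hfr]
      exact fun x hx => hx.elim
    · rw [htop, ENNReal.top_div_of_ne_top (by simp)]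
  have hle : cheegerConstant D w ≤ _ := iInf₂_le D hcomp
  rw [htop, ENNReal.div_top] at hle
  exact h.not_ge hle

theorem integrableOn_of_weightedMeasure_ne_top {D : Set ℂ} {w : ℂ → ℝ}
    (hw : AEStronglyMeasurable w (volume.restrict D)) (hw0 : ∀ z, 0 ≤ w z) (hD : IsOpen D)
    (h : weightedMeasure D w D ≠ ⊤) : IntegrableOn w D volume := by
  refine ⟨hw, ?_⟩
  rw [weightedMeasure, withDensity_apply _ hD.measurableSet, Measure.restrict_restrict
    hD.measurableSet, inter_self] at h
  simpa only [HasFiniteIntegral, Real.enorm_of_nonneg (hw0 _)] using h.lt_top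

theorem mainTheorem3 (D : Set ℂ) (hDo : IsOpen D) (hDc : IsConnected D) (p : ℝ) (hp : 1 ≤ p) :
    (∀ w : ℂ → ℝ, (∀ z ∈ D, 0 ≤ w z) → IntegrableOn w D volume → 0 < cheegerConstant D w →
      (∀ F : ℂ → ℂ, IsMeromorphicSobolev p D w F → MemLp F 1 (weightedMeasure D w) →
        weightedNorm p D w (fun z => F z - weightedMean D w F) ≤
          ENNReal.ofReal (4 * p) / cheegerConstant D w * weightedNorm p D w (gradNorm F)) ∧
      poincareConstant p D w ≤ ENNReal.ofReal (4 * p) / cheegerConstant D w) ∧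
    (∀ f : 𝓢'(ℝ, ℂ),
      poincareConstant p D (gaborWeight p f) ≤
        ENNReal.ofReal (4 * p) / gaborCheegerConstant p D f) := by
  refine ⟨fun w hw0 hw hh => ⟨fun F hF _ => eLpNorm_sub_weightedMean_le hDo hw0 hw hh hp hF,
    poincareConstant_le hDo hw0 hw hh hp⟩, fun f => ?_⟩
  rcases eq_zero_or_pos (cheegerConstant D (gaborWeight p f)) with h0 | hh
  · rw [gaborCheegerConstant, h0, ENNReal.div_zero (by simpa using zero_lt_one.trans_le hp)]
    exact le_top
  · have hw0 : ∀ z, 0 ≤ gaborWeight p f z := fun z => Real.rpow_nonneg (norm_nonneg _) _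
    exact poincareConstant_le hDo (fun z _ => hw0 z)
      (integrableOn_of_weightedMeasure_ne_top
        (continuous_gaborWeight (zero_le_one.trans hp) f).aestronglyMeasurable hw0 hDo
        (weightedMeasure_ne_top_of_cheegerConstant_pos hDo hh)) hh hp
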